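/- Setting. A single item is sold to $n\ge 1$ bidders; bidder $i$'s value is drawn independently from a probability distribution $\mathcal D_i$ on $[0,\infty)$, possibly with unbounded support, and $\mathcal D=\mathcal D_1\times\dots\times\mathcal D_n$. A quantile query $q\in(0,1]$ to $\mathcal D_i$ is answered by $v_i(q)=\max\{z:\Pr_{x\sim\mathcal D_i}[x\ge z]\ge q\}$. The distribution $\mathcal D_i$ is called regular if its revenue curve $q\mapsto q\,v_i(q)$ is concave on $(0,1]$ (for distributions with a positive density on an interval this is monotonicity of the virtual value $v-\frac{1-F(v)}{f(v)}$; an atom at the top of the support is allowed). $OPT(\mathcal D)$ is the supremum of the expected revenue over all feasible, Bayesian incentive compatible and interim individually rational (possibly randomized) mechanisms. Mechanism $\mathcal M_{EMR}$ with parameter $\epsilon\in(0,1)$. Put $\delta=\frac{\epsilon}{4}$, $\epsilon_1=\frac{\epsilon^2}{256n}$, $k=\lceil\log_{1+\delta}\frac1{\epsilon_1}\rceil$, $q_0=1$, $q_l=\epsilon_1(1+\delta)^{k-l}$ for $1\le l\le k$, and $q_{k+1}=0$. For each bidder $i$, make the $k+1$ non-adaptive quantile queries $q_0,\dots,q_k$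 to $\mathcal D_i$, receive answers $v_{i,0}\le\dots\le v_{i,k}$, and let $\mathcal D_i'$ be the discrete distribution that puts mass $q_l-q_{l+1}$ on $v_{i,l}$ for $0\le l\le k$ (masses on equal values are added). Then run Myerson's mechanism for the prior $\mathcal D'=\mathcal D_1'\times\dots\times\mathcal D_n'$ on the reported values: each bid is rounded down to the support of $\mathcal D_i'$ (a bid below the support never wins), the item goes to the bidder with the highest ironed virtual value if it is nonnegative, ties being broken in favour of the smallest index, and the winner pays the least bid with which she would still win. Theorem. For every $n\ge1$, every $\epsilon\in(0,1)$ and all regular $\mathcal D_1,\dots,\mathcal D_n$, all queries of $\mathcal M_{EMR}$ lie in $(0,1]$; the resulting auction is feasible, dominant-strategy incentive compatible and ex-post individually rational; its payments are integrable under truthful reports; and $$Rev(\mathcal M_{EMR}(\mathcal D))\ \ge\ \frac{OPT(\mathcal D)}{1+\epsilon}$$ (in particular $OPT(\mathcal D)<\infty$). The query complexity is $O\!\left(n\log_{1+\epsilon}\frac n\epsilon\right)$ in the following sense: for every $c>1$ there is a constant $C>0$, depending only on $c$, such that for all $n\ge1$ and $\epsilon\in(0,1)$ with $\frac n\epsilon\ge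 c$, the total number of queries is at most $C\,n\log_{1+\epsilon}\frac n\epsilon$. -/

import Mathlib

open MeasureTheory Set

noncomputable section

/-! ## Quantiles, the quantile oracle, and regular distributions -/

/-- The quantile `q(z) = Pr_{x ∼ μ}[x ≥ z]` of the value `z`. -/
def survival (μ : Measure ℝ) (z : ℝ) : ℝ := μ.real (Ici z)

/-- The oracle's answer `v(q) = max {z | Pr_{x ∼ μ}[x ≥ z] ≥ q}` to the quantile query `q`.
For a probability measure on `[0, ∞)` and `0 < q ≤ 1` this set is nonempty, bounded above and
contains its supremum, so `sSup` is a genuine maximum. -/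
def quantileOracle (μ : Measure ℝ) (q : ℝ) : ℝ := sSup {z : ℝ | q ≤ survival μ z}

/-- A distribution is regular if its revenue curve `q ↦ q · v(q)` (the revenue, in quantile
space, of selling to a single bidder with probability `q`) is concave.  For distributions with a
positive density `f` on an interval this says that `v - (1 - F v) / f v` is nondecreasing; an atom
at the largest value is allowed. -/
def IsRegularDist (μ : Measure ℝ) : Prop :=
  ConcaveOn ℝ (Ioc 0 1) (fun q => q * quantileOracle μ q)

/-! ## Single-item mechanisms -/

/-- A direct single-item mechanism for `n` bidders: `alloc b i` is the probability that bidder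
`i` gets the item and `pay b i` is the (expected) payment of `i`, when the reports are `b`. -/
structure Mechanism (n : ℕ) where
  alloc : (Fin n → ℝ) → Fin n → ℝ
  pay : (Fin n → ℝ) → Fin n → ℝ

namespace Mechanism

variable {n : ℕ}

/-- The item is allocated at most once. -/
def IsFeasible (M : Mechanism n) : Prop :=
  ∀ b, (∀ i, 0 ≤ M.alloc b i) ∧ ∑ i, M.alloc b i ≤ 1

/-- Utility of bidder `i` with value `t` when the reports are `b`. -/
def utility (M : Mechanism n) (i : Fin n) (t : ℝ) (b : Fin n → ℝ) : ℝ :=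
  t * M.alloc b i - M.pay b i

/-- Dominant-strategy incentive compatibility: whatever the others report, no bidder gains by
misreporting. -/
def IsDSIC (M : Mechanism n) : Prop :=
  ∀ (i : Fin n) (b : Fin n → ℝ), (∀ j, 0 ≤ b j) → ∀ w : ℝ, 0 ≤ w →
    M.utility i (b i) (Function.update b i w) ≤ M.utility i (b i) b

/-- Ex-post individual rationality: truthful bidders never have negative utility. -/
def IsExPostIR (M : Mechanism n) : Prop :=
  ∀ (i : Fin n) (b : Fin n → ℝ), (∀ j, 0 ≤ b j) → 0 ≤ M.utility i (b i) b

/-- Interim expected utility of bidder `i` with value `t` reporting `w`, the other bidders'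
values being drawn from the prior and reported truthfully. -/
def interimUtility (M : Mechanism n) (D : Fin n → Measure ℝ) (i : Fin n) (t w : ℝ) : ℝ :=
  ∫ v, M.utility i t (Function.update v i w) ∂(Measure.pi D)

/-- Expected revenue under truthful reports, when values are drawn from `D`. -/
def revenue (M : Mechanism n) (D : Fin n → Measure ℝ) : ℝ :=
  ∫ v, ∑ i, M.pay v i ∂(Measure.pi D)

/-- Feasible, Bayesian incentive compatible and interim individually rational mechanisms for the
prior `D`, with all expectations involved well defined. Types and reports of bidder `i` range over
the support of `D i`. -/
structure IsBIC (M : Mechanism n) (D : Fin n → Measure ℝ) : Prop where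
  feasible : M.IsFeasible
  measurable_alloc : ∀ i, Measurable fun v => M.alloc v i
  measurable_pay : ∀ i, Measurable fun v => M.pay v i
  integrable_pay : ∀ i, Integrable (fun v => M.pay v i) (Measure.pi D)
  integrable_interim : ∀ i, ∀ w ∈ (D i).support,
    Integrable (fun v => M.pay (Function.update v i w) i) (Measure.pi D)
  truthful : ∀ i, ∀ t ∈ (D i).support, ∀ w ∈ (D i).support,
    M.interimUtility D i t w ≤ M.interimUtility D i t t
  rational : ∀ i, ∀ t ∈ (D i).support, 0 ≤ M.interimUtility D i t t

end Mechanism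

/-- The optimal BIC revenue of the instance `D`, as an extended real. -/
def optBIC {n : ℕ} (D : Fin n → Measure ℝ) : EReal :=
  ⨆ (M : Mechanism n) (_ : M.IsBIC D), (M.revenue D : EReal)

/-! ## Myerson's mechanism for finitely supported distributions -/

/-- The ironed revenue curve of `μ`: the least concave majorant, in quantile space, of the origin
and the points `(q, p * q)`, where `q` is the probability of sale at the price `p ≥ 0`; written as
the infimum of the affine majorants. -/
def ironedRevenue (μ : Measure ℝ) (q : ℝ) : ℝ :=
  sInf {r : ℝ | ∃ α β : ℝ, 0 ≤ β ∧
    (∀ p : ℝ, 0 ≤ p → p * survival μ p ≤ α * survival μ p + β) ∧ r = α * q + β}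

/-- The ironed virtual value of an atom `v` of `μ`: the slope of the ironed revenue curve over the
quantile interval `[Pr[x > v], Pr[x ≥ v]]` occupied by `v`. -/
def ironedVirtualValue (μ : Measure ℝ) (v : ℝ) : ℝ :=
  (ironedRevenue μ (μ.real (Ici v)) - ironedRevenue μ (μ.real (Ioi v))) / μ.real {v}

open Classical in
/-- The ironed virtual value of an arbitrary bid: the bid is rounded down to the support of
the finitely supported `μ`; bids below the whole support are never served. -/
def virtualBid (μ : Measure ℝ) (b : ℝ) : EReal :=
  if ∃ v ≤ b, μ {v} ≠ 0 then (ironedVirtualValue μ (sSup {v | v ≤ b ∧ μ {v} ≠ 0}) : EReal) else ⊥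

/-- Bidder `i` wins if her ironed virtual value is nonnegative and the highest, ties being broken
in favour of the smallest index. -/
def myersonWins {n : ℕ} (D : Fin n → Measure ℝ) (b : Fin n → ℝ) (i : Fin n) : Prop :=
  0 ≤ virtualBid (D i) (b i) ∧ ∀ j, j ≠ i →
    virtualBid (D j) (b j) < virtualBid (D i) (b i) ∨
      (virtualBid (D j) (b j) = virtualBid (D i) (b i) ∧ i < j)

open Classical in
/-- Myerson's mechanism run with the finitely supported prior `D`: the winner pays the threshold
bid, i.e. the least bid with which she would still win. -/
def myerson {n : ℕ} (D : Fin n → Measure ℝ) : Mechanism n where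
  alloc b i := if myersonWins D b i then 1 else 0
  pay b i := if myersonWins D b i then
    sInf {z : ℝ | 0 ≤ z ∧ myersonWins D (Function.update b i z) i} else 0

/-! ## Query mechanisms -/

/-- A mechanism with non-adaptive quantile-query access to the prior: all queries are fixed in
advance, and the auction that is run depends on the prior only through the oracle's answers. -/
structure QueryMechanism (n : ℕ) where
  numQueries : Fin n → ℕ
  query : (i : Fin n) → Fin (numQueries i) → ℝ
  run : ((i : Fin n) → Fin (numQueries i) → ℝ) → Mechanism n

namespace QueryMechanism

variable {n : ℕ}

/-- The query complexity: the total number of queries made. -/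
def queryComplexity (Q : QueryMechanism n) : ℕ := ∑ i, Q.numQueries i

/-- The auction that is run when the oracle answers according to `D`. -/
def exec (Q : QueryMechanism n) (D : Fin n → Measure ℝ) : Mechanism n :=
  Q.run fun i l => quantileOracle (D i) (Q.query i l)

end QueryMechanism

/-- `k = ⌈log_{1+δ} (1/ε₁)⌉`. -/
def quantileLevels (δ ε₁ : ℝ) : ℕ := ⌈Real.logb (1 + δ) (1 / ε₁)⌉₊

/-- The quantile vector `q₀ = 1`, `q_l = ε₁ (1+δ)^(k-l)` for `1 ≤ l ≤ k`, and `q_{k+1} = 0`. -/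
def quantileVector (δ ε₁ : ℝ) (l : ℕ) : ℝ :=
  if l = 0 then 1
  else if l ≤ quantileLevels δ ε₁ then ε₁ * (1 + δ) ^ (quantileLevels δ ε₁ - l)
  else 0

/-- The discrete distribution built by the quantile-query algorithm from the answers
`v₀, …, v_k`: it puts mass `q_l - q_{l+1}` on `v_l`. -/
def learnedDistribution (δ ε₁ : ℝ) (v : Fin (quantileLevels δ ε₁ + 1) → ℝ) : Measure ℝ :=
  ∑ l : Fin (quantileLevels δ ε₁ + 1),
    ENNReal.ofReal (quantileVector δ ε₁ l - quantileVector δ ε₁ (l + 1)) • Measure.dirac (v l)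

/-- The efficient quantile Myerson mechanism with parameters `δ` and `ε₁`: learn a discrete
distribution for each bidder with the quantile-query algorithm, then run Myerson's mechanism. -/
def quantileMyerson (n : ℕ) (δ ε₁ : ℝ) : QueryMechanism n where
  numQueries _ := quantileLevels δ ε₁ + 1
  query _ l := quantileVector δ ε₁ l
  run v := myerson fun i => learnedDistribution δ ε₁ (v i)

/-- The mechanism `M_EMR` for regular distributions: `δ = ε/4` and `ε₁ = ε²/(256 n)`. -/
def mechanismEMR (n : ℕ) (ε : ℝ) : QueryMechanism n :=
  quantileMyerson n (ε / 4) (ε ^ 2 / (256 * n))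

end

/-! The optimum and the auction are both compared with the positive part φᵢ⁺ of the virtual value
read off the sampled revenue curve (`positiveValue`), evaluated at the true values. Write e for ε₁,
R for the revenue curve and v(q) for the oracle's answer.

Regularity is used in three ways. A concave sampled curve is its own ironing, so ironed virtual
values are plain slopes (`ironedVirtualValue_eq`). A value occupying an interval of quantiles must
be the maximum of the support (`quantileOracle_eq_of_eq`), so oracle answers can only tie at the
top. Finally R(q) ≤ R(e)/(1-e) for q ≤ e (`revenue_le_div`), which controls unqueried prices however
long the tail is.

Upper bound on any BIC mechanism. Let a be a bidder's interim allocation and u_m = v(Q_m), where Q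
continues the quantile vector geometrically below e. Incentive compatibility bounds each payment by
allocation increments times types, rounded up along u (`payment_le`). Since consecutive Q's differ
by a factor at most 1+δ, integration gives at most (1+δ) Σ Δa_m Q_m u_m. The revenue Q_m u_m of a
price is at most the virtual value lying above it, up to a constant Cᵢ = R(e)/(1-e) that pays for a
top region Aᵢ of mass at most e (`integral_pay_le_of_isRegularDist`). Reassembling the increments
and summing over bidders gives (1+δ)(Σ Cᵢ + E max φᵢ⁺ outside Aᵢ). When v(e) is an atom of survival
above e, Aᵢ is empty and Cᵢ = 0.

Lower bound on the auction. Its virtual surplus is at least max φᵢ⁺. The events that bidders lie in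
their top regions are independent with probability at most e each, so collisions cost only a factor
1-ne (`truncation_le`), and the top value of Aᵢ collects exactly (1-e)Cᵢ. Each bidder faces a
sampled price as her threshold, and the virtual value above such a price is at most 1+δ times its
true revenue (`setIntegral_le_revenue`). Together, (1-e)(1-ne) Rev(M) ≤ (1+δ)² Rev
(`quantileMyerson_approx`), and the chosen parameters turn this into the factor 1+ε. -/

open Filter Topology

/-! ## The quantile oracle -/

section Quantile

variable {μ : Measure ℝ} [IsProbabilityMeasure μ]

lemma survival_antitone (μ : Measure ℝ) [IsProbabilityMeasure μ] : Antitone (survival μ) :=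
  fun _ _ h => measureReal_mono (Ici_subset_Ici.2 h)

lemma survival_nonneg (μ : Measure ℝ) (z : ℝ) : 0 ≤ survival μ z := measureReal_nonneg

lemma survival_le_one (μ : Measure ℝ) [IsProbabilityMeasure μ] (z : ℝ) : survival μ z ≤ 1 :=
  measureReal_le_one

lemma survival_of_nonpos (h0 : μ (Iio 0) = 0) {z : ℝ} (hz : z ≤ 0) : survival μ z = 1 := by
  have h : μ (Iio z) = 0 := measure_mono_null (Iio_subset_Iio hz) h0
  have := prob_compl_eq_one_iff (μ := μ) (measurableSet_Iio (a := z)) |>.2 h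
  rw [compl_Iio] at this
  simp [survival, measureReal_def, this]

lemma tendsto_survival_atTop (μ : Measure ℝ) [IsProbabilityMeasure μ] :
    Tendsto (survival μ) atTop (𝓝 0) := by
  have h : Tendsto (fun z : ℝ => μ (Ici z)) atTop (𝓝 0) := by
    have := tendsto_measure_iInter_atTop (μ := μ) (s := fun z : ℝ => Ici z)
      (fun z => measurableSet_Ici.nullMeasurableSet) (fun a b h => Ici_subset_Ici.2 h)
      ⟨0, measure_ne_top _ _⟩
    have he : ⋂ z : ℝ, Ici z = ∅ := by
      ext x
      simp only [mem_iInter, mem_Ici, mem_empty_iff_false, iff_false, not_forall, not_le]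
      exact exists_gt x
    simpa only [he, measure_empty, Function.comp_def] using this
  have := (ENNReal.tendsto_toReal ENNReal.zero_ne_top).comp h
  exact this

lemma bddAbove_setOf_le_survival (μ : Measure ℝ) [IsProbabilityMeasure μ] {q : ℝ} (hq : 0 < q) :
    BddAbove {z : ℝ | q ≤ survival μ z} := by
  obtain ⟨b, hb⟩ := ((tendsto_survival_atTop μ).eventually (gt_mem_nhds hq)).exists
  refine ⟨b, fun z hz => ?_⟩
  by_contra! h
  exact absurd (hz.trans (survival_antitone μ h.le)) (not_le.2 hb)

/-- Left continuity of the survival function, from continuity of the measure along decreasing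
half-lines; it is what makes the oracle's supremum a maximum. -/
lemma le_survival_of_forall_lt {q z : ℝ} (h : ∀ y < z, q ≤ survival μ y) : q ≤ survival μ z := by
  obtain ⟨u, hu, hlt, hlim⟩ := exists_seq_strictMono_tendsto z
  have hi : ⋂ n, Ici (u n) = Ici z := by
    ext x
    simp only [mem_iInter, mem_Ici]
    exact ⟨fun hx => le_of_tendsto' hlim hx, fun hx n => (hlt n).le.trans hx⟩
  have := tendsto_measure_iInter_atTop (μ := μ) (s := fun n => Ici (u n))
    (fun z => measurableSet_Ici.nullMeasurableSet) (fun a b h => Ici_subset_Ici.2 (hu.monotone h))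
    ⟨0, measure_ne_top _ _⟩
  rw [hi] at this
  have := (ENNReal.tendsto_toReal (measure_ne_top μ (Ici z))).comp this
  exact ge_of_tendsto' this fun n => h _ (hlt n)

/-- The oracle is adjoint to the quantile function. -/
lemma le_quantileOracle_iff (h0 : μ (Iio 0) = 0) {q z : ℝ} (hq : 0 < q) (hq1 : q ≤ 1) :
    z ≤ quantileOracle μ q ↔ q ≤ survival μ z := by
  have hne : {z : ℝ | q ≤ survival μ z}.Nonempty :=
    ⟨0, by simpa [survival_of_nonpos h0 le_rfl] using hq1⟩
  refine ⟨fun h => le_survival_of_forall_lt fun y hy => ?_,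
    fun h => le_csSup (bddAbove_setOf_le_survival μ hq) h⟩
  obtain ⟨w, hw, hyw⟩ := exists_lt_of_lt_csSup hne (hy.trans_le h)
  exact le_trans hw (survival_antitone μ hyw.le)

lemma le_survival_quantileOracle (h0 : μ (Iio 0) = 0) {q : ℝ} (hq : 0 < q) (hq1 : q ≤ 1) :
    q ≤ survival μ (quantileOracle μ q) :=
  (le_quantileOracle_iff h0 hq hq1).1 le_rfl

lemma survival_lt_of_quantileOracle_lt (h0 : μ (Iio 0) = 0) {q z : ℝ} (hq : 0 < q) (hq1 : q ≤ 1)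
    (h : quantileOracle μ q < z) : survival μ z < q := by
  by_contra! h'
  exact absurd ((le_quantileOracle_iff h0 hq hq1).2 h') (not_le.2 h)

lemma quantileOracle_nonneg (h0 : μ (Iio 0) = 0) {q : ℝ} (hq : 0 < q) (hq1 : q ≤ 1) :
    0 ≤ quantileOracle μ q :=
  (le_quantileOracle_iff h0 hq hq1).2 (by rwa [survival_of_nonpos h0 le_rfl])

lemma quantileOracle_anti (h0 : μ (Iio 0) = 0) {q q' : ℝ} (hq : 0 < q) (hq1 : q' ≤ 1)
    (h : q ≤ q') : quantileOracle μ q' ≤ quantileOracle μ q :=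
  (le_quantileOracle_iff h0 hq (h.trans hq1)).2
    (h.trans (le_survival_quantileOracle h0 (hq.trans_le h) hq1))

lemma measureReal_Ioi_quantileOracle_le (h0 : μ (Iio 0) = 0) {q : ℝ} (hq : 0 < q) (hq1 : q ≤ 1) :
    μ.real (Ioi (quantileOracle μ q)) ≤ q := by
  set z := quantileOracle μ q
  obtain ⟨u, hu, hlt, hlim⟩ := exists_seq_strictAnti_tendsto z
  have hi : ⋃ n, Ici (u n) = Ioi z := by
    ext x
    simp only [mem_iUnion, mem_Ici, mem_Ioi]
    refine ⟨fun ⟨n, hx⟩ => (hlt n).trans_le hx, fun hx => ?_⟩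
    obtain ⟨n, hn⟩ := (hlim.eventually (gt_mem_nhds hx)).exists
    exact ⟨n, hn.le⟩
  have := tendsto_measure_iUnion_atTop (μ := μ) (s := fun n => Ici (u n))
    (fun a b h => Ici_subset_Ici.2 (hu.antitone h))
  rw [hi] at this
  have := (ENNReal.tendsto_toReal (measure_ne_top μ (Ioi z))).comp this
  exact le_of_tendsto' this fun n => (survival_lt_of_quantileOracle_lt h0 hq hq1 (hlt n)).le

/-- Survival drops below q immediately to the right of v(q), so every neighbourhood carries mass.
The BIC constraints hold only on the support, so the types used for rounding must lie there. -/
lemma quantileOracle_mem_support (h0 : μ (Iio 0) = 0) {q : ℝ} (hq : 0 < q) (hq1 : q ≤ 1) :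
    quantileOracle μ q ∈ μ.support := by
  set z := quantileOracle μ q with hz
  rw [Measure.mem_support_iff_forall]
  intro U hU
  obtain ⟨ε, hε, hb⟩ := Metric.mem_nhds_iff.1 hU
  have h1 := le_survival_quantileOracle (μ := μ) h0 hq hq1
  have h2 : survival μ (z + ε) < q :=
    survival_lt_of_quantileOracle_lt h0 hq hq1 (by linarith)
  rw [pos_iff_ne_zero]
  intro hU0
  have h3 : μ (Ico z (z + ε)) = 0 := by
    refine measure_mono_null (fun x hx => hb ?_) hU0
    rw [Metric.mem_ball, Real.dist_eq, abs_lt]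
    constructor <;> linarith [hx.1, hx.2]
  have h4 : survival μ z ≤ μ.real (Ico z (z + ε)) + survival μ (z + ε) := by
    have : Ici z ⊆ Ico z (z + ε) ∪ Ici (z + ε) := fun x hx => by
      rcases lt_or_ge x (z + ε) with h | h
      · exact Or.inl ⟨hx, h⟩
      · exact Or.inr h
    exact (measureReal_mono this).trans (measureReal_union_le _ _)
  rw [measureReal_def, h3] at h4
  simp only [ENNReal.toReal_zero, zero_add] at h4
  linarith

omit [IsProbabilityMeasure μ] in
lemma nonneg_of_mem_support (h0 : μ (Iio 0) = 0) {t : ℝ} (ht : t ∈ μ.support) : 0 ≤ t := by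
  by_contra! h
  exact absurd h0 ((Measure.mem_support_iff_forall t).1 ht _ (Iio_mem_nhds h)).ne'

/-! ### Consequences of concavity of the revenue curve -/

section Regular

variable (h0 : μ (Iio 0) = 0) (hreg : IsRegularDist μ)
include h0 hreg

/-- A value that occupies an interval of quantiles of a regular distribution is its maximum. -/
lemma quantileOracle_eq_of_eq {q q₁ q₂ : ℝ} (hq : 0 < q) (h1 : q < q₁) (h2 : q₁ < q₂)
    (h3 : q₂ ≤ 1) (h : quantileOracle μ q₁ = quantileOracle μ q₂) :
    quantileOracle μ q = quantileOracle μ q₁ := by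
  refine le_antisymm ?_ (quantileOracle_anti h0 hq (h2.le.trans h3) h1.le)
  -- Over [q₁, q₂] the revenue curve has slope equal to the common value; concavity makes the slope
  -- over [q, q₁] at least that, which forces v(q) ≤ v(q₁).
  have := hreg.slope_anti_adjacent ⟨hq, by linarith⟩ ⟨by linarith, h3⟩ h1 h2
  simp only [← h] at this
  rw [show (q₂ * quantileOracle μ q₁ - q₁ * quantileOracle μ q₁) / (q₂ - q₁)
    = quantileOracle μ q₁ by field_simp [(sub_pos.2 h2).ne'],
    le_div_iff₀ (sub_pos.2 h1)] at this
  nlinarith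

/-- If survival at v(q) exceeds q, then v is constant from q up to that survival, and the preceding
lemma carries the constant to all smaller quantiles. -/
lemma quantileOracle_eq_of_lt_survival {q q' : ℝ} (hq : 0 < q) (hq1 : q ≤ 1) (hq' : 0 < q')
    (h : q < survival μ (quantileOracle μ q))
    (h' : q' ≤ survival μ (quantileOracle μ q)) : quantileOracle μ q' = quantileOracle μ q := by
  set s := survival μ (quantileOracle μ q) with hs
  have hs1 : s ≤ 1 := survival_le_one μ _
  have e : quantileOracle μ q = quantileOracle μ s :=
    le_antisymm ((le_quantileOracle_iff h0 (hq.trans h) hs1).2 hs.le)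
      (quantileOracle_anti h0 hq hs1 h.le)
  rcases lt_trichotomy q' q with hlt | rfl | hgt
  · exact quantileOracle_eq_of_eq h0 hreg hq' hlt h hs1 e
  · rfl
  · exact le_antisymm (quantileOracle_anti h0 hq (h'.trans hs1) hgt.le)
      (e.le.trans (quantileOracle_anti h0 hq' hs1 h'))

/-- The revenue curve is nonnegative at 1, so concavity on [q, 1] gives R(e) ≥ R(q)(1-e)/(1-q) ≥
(1-e)R(q). -/
lemma revenue_le_div {q e : ℝ} (hq : 0 < q) (hqe : q ≤ e) (he : e < 1) :
    q * quantileOracle μ q ≤ e * quantileOracle μ e / (1 - e) := by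
  have hR := quantileOracle_nonneg (μ := μ) h0 one_pos le_rfl
  have hRq := quantileOracle_nonneg (μ := μ) h0 hq (by linarith)
  have hRe := quantileOracle_nonneg (μ := μ) h0 (hq.trans_le hqe) he.le
  rw [le_div_iff₀ (by linarith)]
  rcases hqe.eq_or_lt with rfl | hlt
  · nlinarith [mul_nonneg hq.le hRq]
  have := hreg.slope_anti_adjacent ⟨hq, by linarith⟩ ⟨one_pos, le_rfl⟩ hlt he
  rw [div_le_div_iff₀ (by linarith) (by linarith)] at this
  nlinarith [mul_nonneg hq.le hRq, mul_nonneg hR (sub_pos.2 hlt).le,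
    mul_nonneg (mul_nonneg (hq.trans_le hqe).le hRe) hq.le]

end Regular

end Quantile

/-! ## Discretised revenue curves -/

/-- A concave revenue curve sampled at the quantiles `q 0 = 1 > q 1 > ⋯ > q k`, completed by
`q (k + 1) = 0`; the value of quantile `q l` is `v l`. -/
structure RevenueGrid (k : ℕ) (q v : ℕ → ℝ) : Prop where
  zero : q 0 = 1
  last : q (k + 1) = 0
  lt_succ : ∀ l ≤ k, q (l + 1) < q l
  nonneg : ∀ l ≤ k, 0 ≤ v l
  mono : ∀ l m, l ≤ m → m ≤ k → v l ≤ v m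
  concave : ∀ a b c, a < b → b < c → c ≤ k →
    (q a * v a - q b * v b) / (q a - q b) ≤ (q b * v b - q c * v c) / (q b - q c)
  tie : ∀ l < k, v l = v (l + 1) → v (l + 1) = v k

/-- The slope of the sampled revenue curve over `[q (l + 1), q l]`. -/
noncomputable def levelValue (q v : ℕ → ℝ) (l : ℕ) : ℝ :=
  (q l * v l - q (l + 1) * v (l + 1)) / (q l - q (l + 1))

/-- The discrete distribution with mass `q l - q (l + 1)` on `v l`. -/
noncomputable def gridMeasure (k : ℕ) (q v : ℕ → ℝ) : Measure ℝ :=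
  ∑ l : Fin (k + 1), ENNReal.ofReal (q l - q (l + 1)) • Measure.dirac (v l)

/-- The increments in `l` of the positive part of `levelValue q v l`. -/
noncomputable def levelIncrement (q v : ℕ → ℝ) : ℕ → ℝ
  | 0 => max (levelValue q v 0) 0
  | l + 1 => max (levelValue q v (l + 1)) 0 - max (levelValue q v l) 0

open Classical in
/-- The positive part of the virtual value of a bid rounded down to the grid. -/
noncomputable def positiveValue (k : ℕ) (q v : ℕ → ℝ) (t : ℝ) : ℝ :=
  ∑ l ∈ Finset.range (k + 1), if v l ≤ t then levelIncrement q v l else 0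

lemma sum_levelIncrement (q v : ℕ → ℝ) (l : ℕ) :
    ∑ m ∈ Finset.range (l + 1), levelIncrement q v m = max (levelValue q v l) 0 := by
  induction l with
  | zero => simp [levelIncrement]
  | succ l ih => rw [Finset.sum_range_succ, ih, levelIncrement]; ring

/-- The value m = k + 1 encodes that P never holds, matching the quantile q (k + 1) = 0. -/
lemma exists_threshold_of_monotone {k : ℕ} {P : ℕ → Prop}
    (hP : ∀ l m, l ≤ m → m ≤ k → P l → P m) : ∃ m ≤ k + 1, ∀ l ≤ k, P l ↔ m ≤ l := by
  classical
  by_cases h : ∃ l, l ≤ k ∧ P l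
  · exact ⟨Nat.find h, (Nat.find_spec h).1.trans (Nat.le_succ _), fun l hl =>
      ⟨fun hp => Nat.find_min' h ⟨hl, hp⟩, fun hp => hP _ _ hp hl (Nat.find_spec h).2⟩⟩
  · push Not at h
    exact ⟨k + 1, le_rfl, fun l hl => ⟨fun hp => absurd hp (h l hl), fun hp => by omega⟩⟩

namespace RevenueGrid

variable {k : ℕ} {q v : ℕ → ℝ} (G : RevenueGrid k q v)
include G

lemma lt_of_lt {l m : ℕ} (h : l < m) (hm : m ≤ k + 1) : q m < q l := by
  induction m, h using Nat.le_induction with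
  | base => exact G.lt_succ l (by omega)
  | succ m _ ih => exact (G.lt_succ m (by omega)).trans (ih (by omega))

lemma le_of_le {l m : ℕ} (h : l ≤ m) (hm : m ≤ k + 1) : q m ≤ q l := by
  rcases h.eq_or_lt with rfl | h
  · exact le_rfl
  · exact (G.lt_of_lt h hm).le

lemma pos {l : ℕ} (hl : l ≤ k) : 0 < q l := by
  rw [← G.last]
  exact G.lt_of_lt (by omega) le_rfl

lemma levelValue_last : levelValue q v k = v k := by
  rw [levelValue, G.last]
  have := (G.pos (le_refl k)).ne'
  field_simp
  ring

lemma levelValue_le {l : ℕ} (hl : l ≤ k) : levelValue q v l ≤ v l := by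
  rcases hl.eq_or_lt with rfl | hl
  · exact G.levelValue_last.le
  · rw [levelValue, div_le_iff₀ (sub_pos.2 (G.lt_succ l hl.le))]
    nlinarith [G.mono l (l + 1) (Nat.le_succ l) hl, G.pos (l := l + 1) hl]

/-- Slopes increase in l because l runs against the quantile. The segment reaching the origin is not
covered by `concave`; there the slope is v k, which dominates since each slope is at most its own
value. -/
lemma levelValue_mono {l m : ℕ} (h : l ≤ m) (hm : m ≤ k) :
    levelValue q v l ≤ levelValue q v m := by
  induction m, h using Nat.le_induction with
  | base => exact le_rfl
  | succ m _ ih =>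
    refine (ih (by omega)).trans ?_
    rcases hm.eq_or_lt with h | h
    · calc levelValue q v m ≤ v m := G.levelValue_le (by omega)
        _ ≤ v k := G.mono _ _ (by omega) le_rfl
        _ = levelValue q v (m + 1) := by rw [h, G.levelValue_last]
    · exact G.concave m (m + 1) (m + 2) (by omega) (by omega) h

lemma levelValue_of_eq_last {l : ℕ} (hl : l ≤ k) (h : v l = v k) : levelValue q v l = v k := by
  rcases hl.eq_or_lt with rfl | hl
  · exact G.levelValue_last
  · have h' : v (l + 1) = v k :=
      le_antisymm (G.mono _ _ hl le_rfl) (h ▸ G.mono _ _ (Nat.le_succ l) hl)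
    rw [levelValue, h, h', ← sub_mul, mul_div_assoc, mul_comm, div_mul_cancel₀]
    exact (sub_pos.2 (G.lt_succ l hl.le)).ne'

/-- The affine function extending the revenue curve over `[q (l + 1), q l]` majorises it. -/
lemma revenue_le_tangent {l m : ℕ} (hl : l ≤ k) (hm : m ≤ k) :
    q m * v m ≤ q l * v l + levelValue q v l * (q m - q l) := by
  rcases lt_trichotomy m l with h | rfl | h
  · rcases hl.eq_or_lt with rfl | hl
    · rw [G.levelValue_last]
      nlinarith [G.mono _ _ h.le le_rfl, G.pos hm]
    · have := G.concave m l (l + 1) h (Nat.lt_succ_self l) hl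
      rw [div_le_iff₀ (sub_pos.2 (G.lt_of_lt h (by omega)))] at this
      change _ ≤ levelValue q v l * _ at this
      linarith
  · simp
  · have hs := G.lt_succ l hl
    have e : levelValue q v l * (q l - q (l + 1)) = q l * v l - q (l + 1) * v (l + 1) :=
      div_mul_cancel₀ _ (sub_pos.2 hs).ne'
    rcases (Nat.succ_le_of_lt h).eq_or_lt with rfl | h'
    · simp only [Nat.succ_eq_add_one]; linarith
    · have := G.concave l (l + 1) m (Nat.lt_succ_self l) h' hm
      rw [le_div_iff₀ (sub_pos.2 (G.lt_of_lt h' (by omega)))] at this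
      change levelValue q v l * _ ≤ _ at this
      linarith

/-- The tangent lines pass above the origin, as affine majorants in `ironedRevenue` must. -/
lemma intercept_nonneg {l : ℕ} (hl : l ≤ k) : 0 ≤ q l * v l - levelValue q v l * q l := by
  nlinarith [G.levelValue_le hl, G.pos hl]

lemma levelIncrement_nonneg {l : ℕ} (hl : l ≤ k) : 0 ≤ levelIncrement q v l := by
  cases l with
  | zero => exact le_max_right _ _
  | succ l =>
    exact sub_nonneg.2 (max_le_max (G.levelValue_mono (Nat.le_succ l) hl) le_rfl)

/-! ### The discrete distribution of a grid -/

/-- The masses of the levels from m on telescope to q m - q (k + 1). -/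
lemma measureReal_eq {s : Set ℝ} (hs : MeasurableSet s) {m : ℕ} (hm : m ≤ k + 1)
    (h : ∀ l ≤ k, v l ∈ s ↔ m ≤ l) : (gridMeasure k q v).real s = q m := by
  classical
  have h1 : (gridMeasure k q v).real s
      = ∑ l ∈ Finset.range (k + 1), if m ≤ l then q l - q (l + 1) else 0 := by
    rw [measureReal_def, gridMeasure, Measure.coe_finsetSum, Finset.sum_apply,
      ENNReal.toReal_sum (fun l _ => by
        simp [Measure.dirac_apply' _ hs, indicator]; split_ifs <;> simp),
      ← Fin.sum_univ_eq_sum_range (fun l => if m ≤ l then q l - q (l + 1) else 0)]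
    refine Finset.sum_congr rfl fun l _ => ?_
    have hl : (l : ℕ) ≤ k := Nat.lt_succ_iff.1 l.2
    have hp : 0 ≤ q l - q (l + 1) := (sub_pos.2 (G.lt_succ l hl)).le
    by_cases hml : m ≤ l
    · simp [Measure.dirac_apply' _ hs, (h l hl).2 hml, hml, ENNReal.toReal_ofReal hp]
    · simp [Measure.dirac_apply' _ hs, mt (h l hl).1 hml, hml]
  have h2 : ∀ j, m ≤ j → j ≤ k + 1 →
      ∑ l ∈ Finset.range j, (if m ≤ l then q l - q (l + 1) else 0) = q m - q j := by
    intro j hj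
    induction j, hj using Nat.le_induction with
    | base =>
      intro _
      rw [sub_self]
      exact Finset.sum_eq_zero fun l hl => if_neg (by simpa using hl)
    | succ j hj ih =>
      intro hjk
      rw [Finset.sum_range_succ, ih (by omega), if_pos hj]; ring
  rw [h1, h2 _ hm le_rfl, G.last, sub_zero]

omit G in
lemma isFiniteMeasure : IsFiniteMeasure (gridMeasure k q v) := by
  constructor
  simp [gridMeasure, ENNReal.sum_lt_top]

/-! ### Ironing and virtual bids of a grid distribution -/

lemma exists_survival_eq (p : ℝ) : ∃ m ≤ k + 1, (∀ l ≤ k, p ≤ v l ↔ m ≤ l) ∧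
    survival (gridMeasure k q v) p = q m := by
  obtain ⟨m, hm, h⟩ := exists_threshold_of_monotone (k := k) (P := fun l => p ≤ v l)
    (fun l m hlm hm h => h.trans (G.mono l m hlm hm))
  exact ⟨m, hm, h, G.measureReal_eq measurableSet_Ici hm h⟩

lemma exists_measureReal_Ioi_eq (p : ℝ) : ∃ m ≤ k + 1, (∀ l ≤ k, p < v l ↔ m ≤ l) ∧
    (gridMeasure k q v).real (Ioi p) = q m := by
  obtain ⟨m, hm, h⟩ := exists_threshold_of_monotone (k := k) (P := fun l => p < v l)
    (fun l m hlm hm h => h.trans_le (G.mono l m hlm hm))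
  exact ⟨m, hm, h, G.measureReal_eq measurableSet_Ioi hm h⟩

/-- Nothing is ironed: the tangent at level j is an affine majorant touching the curve there. The
hypothesis says that the point is genuinely attained, by the price v j or as the origin, so no
majorant can pass below it. -/
lemma ironedRevenue_eq {j : ℕ}
    (h : j = k + 1 ∨ j ≤ k ∧ survival (gridMeasure k q v) (v j) = q j) :
    ironedRevenue (gridMeasure k q v) (q j) = q j * v j := by
  apply IsLeast.csInf_eq
  constructor
  · have hmaj : ∀ l ≤ k, ∀ p : ℝ, 0 ≤ p → p * survival (gridMeasure k q v) p ≤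
        levelValue q v l * survival (gridMeasure k q v) p
          + (q l * v l - levelValue q v l * q l) := by
      intro l hl p hp
      obtain ⟨m, hm, hpm, hS⟩ := G.exists_survival_eq p
      rw [hS]
      rcases hm.eq_or_lt with rfl | hm
      · rw [G.last]
        simpa using G.intercept_nonneg hl
      · have hm' : m ≤ k := by omega
        have := (hpm m hm').2 le_rfl
        have := G.revenue_le_tangent hl hm'
        nlinarith [G.pos hm']
    rcases h with rfl | ⟨hj, -⟩
    · refine ⟨levelValue q v k, _, G.intercept_nonneg le_rfl, hmaj k le_rfl, ?_⟩
      rw [G.last, G.levelValue_last]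
      ring
    · exact ⟨levelValue q v j, _, G.intercept_nonneg hj, hmaj j hj, by ring⟩
  · rintro r ⟨α, β, hβ, hmaj, rfl⟩
    rcases h with rfl | ⟨hj, hS⟩
    · simpa [G.last] using hβ
    · have := hmaj (v j) (G.nonneg j hj)
      rw [hS] at this
      linarith

lemma ironedVirtualValue_eq {l : ℕ} (hl : l ≤ k) :
    ironedVirtualValue (gridMeasure k q v) (v l) = levelValue q v l := by
  have := isFiniteMeasure (k := k) (q := q) (v := v)
  obtain ⟨a, -, ha, hSa⟩ := G.exists_survival_eq (v l)
  obtain ⟨b, hb, hb', hSb⟩ := G.exists_measureReal_Ioi_eq (v l)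
  have hal : a ≤ l := (ha l hl).1 le_rfl
  have hlb : l < b := by
    by_contra! h
    exact absurd ((hb' l hl).2 h) (lt_irrefl _)
  have hva : v a = v l :=
    le_antisymm (G.mono _ _ hal hl) ((ha a (hal.trans hl)).2 le_rfl)
  have hsing : (gridMeasure k q v).real {v l} = q a - q b := by
    rw [← hSa, ← hSb, survival, ← measureReal_sdiff Ioi_subset_Ici_self measurableSet_Ioi]
    congr 1
    ext x
    simp only [mem_singleton_iff, Set.mem_sdiff, mem_Ici, mem_Ioi, not_lt]
    exact ⟨fun h => ⟨h.ge, h.le⟩, fun h => le_antisymm h.2 h.1⟩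
  change (ironedRevenue _ (survival _ _) - _) / _ = _
  rw [hsing, hSa, hSb, G.ironedRevenue_eq (Or.inr ⟨hal.trans hl, hva ▸ hSa⟩),
    G.ironedRevenue_eq (j := b) ?_]
  · rcases (show a + 1 ≤ b by omega).eq_or_lt with rfl | h
    · obtain rfl : l = a := by omega
      rfl
    -- Several levels share this value, so by `tie` it is the top one, its quantile interval reaches
    -- down to 0, and the slope is the value itself.
    · have hav : v (a + 1) = v a := by
        refine le_antisymm ?_ (G.mono _ _ (Nat.le_succ a) (by omega))
        by_contra! hlt
        exact absurd ((hb' (a + 1) (by omega)).1 (hva ▸ hlt)) (by omega)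
      have hk := G.tie a (by omega) hav.symm
      have hbk : b = k + 1 := by
        by_contra hne
        have := (hb' k le_rfl).2 (by omega)
        rw [← hk, hav, hva] at this
        exact lt_irrefl _ this
      rw [G.levelValue_of_eq_last hl (by rw [← hva, ← hav, hk]), hbk, G.last, ← hk, hav]
      have := (G.pos (hal.trans hl)).ne'
      field_simp
      ring
  · rcases hb.eq_or_lt with h | h
    · exact Or.inl h
    · have hbk : b ≤ k := by omega
      refine Or.inr ⟨hbk, G.measureReal_eq measurableSet_Ici hb fun j hj => ?_⟩
      have hvb := (hb' b hbk).2 le_rfl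
      refine ⟨fun hj' => (hb' j hj).1 (hvb.trans_le hj'), fun h => G.mono _ _ h hj⟩

lemma gridMeasure_singleton_ne_zero {x : ℝ} :
    gridMeasure k q v {x} ≠ 0 ↔ ∃ l ≤ k, v l = x := by
  simp only [gridMeasure, Measure.coe_finsetSum, Finset.sum_apply, Measure.smul_apply,
    Measure.dirac_apply' _ (measurableSet_singleton x), smul_eq_mul, ne_eq,
    Finset.sum_eq_zero_iff, Finset.mem_univ, forall_true_left, mul_eq_zero, not_forall, not_or,
    ENNReal.ofReal_eq_zero, not_le]
  constructor
  · rintro ⟨l, -, h⟩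
    exact ⟨l, Nat.lt_succ_iff.1 l.2, by
      by_contra hne
      exact h (indicator_of_notMem (by simpa using hne) _)⟩
  · rintro ⟨l, hl, rfl⟩
    exact ⟨⟨l, by omega⟩, sub_pos.2 (G.lt_succ l hl), by simp⟩

/-- Rounding down to the grid. -/
lemma exists_level {b : ℝ} (hb : v 0 ≤ b) : ∃ l ≤ k, ∀ m ≤ k, v m ≤ b ↔ m ≤ l := by
  classical
  have hs := Nat.findGreatest_spec (P := fun l => v l ≤ b) (Nat.zero_le k) hb
  have hle := Nat.findGreatest_le (P := fun l => v l ≤ b) k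
  refine ⟨Nat.findGreatest (fun l => v l ≤ b) k, hle, fun m hm =>
    ⟨fun h => Nat.le_findGreatest hm h, fun h => (G.mono _ _ h hle).trans hs⟩⟩

lemma virtualBid_eq {b : ℝ} {l : ℕ} (hl : l ≤ k) (h : ∀ m ≤ k, v m ≤ b ↔ m ≤ l) :
    virtualBid (gridMeasure k q v) b = (levelValue q v l : EReal) := by
  have hlb := (h l hl).2 le_rfl
  rw [virtualBid, if_pos ⟨v l, hlb, G.gridMeasure_singleton_ne_zero.2 ⟨l, hl, rfl⟩⟩,
    ← G.ironedVirtualValue_eq hl]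
  congr 2
  refine IsGreatest.csSup_eq ⟨⟨hlb, G.gridMeasure_singleton_ne_zero.2 ⟨l, hl, rfl⟩⟩, ?_⟩
  rintro x ⟨hx, hx'⟩
  obtain ⟨m, hm, rfl⟩ := G.gridMeasure_singleton_ne_zero.1 hx'
  exact G.mono _ _ ((h m hm).1 hx) hl

lemma virtualBid_of_lt {b : ℝ} (hb : b < v 0) : virtualBid (gridMeasure k q v) b = ⊥ := by
  rw [virtualBid, if_neg]
  rintro ⟨x, hx, hx'⟩
  obtain ⟨m, hm, rfl⟩ := G.gridMeasure_singleton_ne_zero.1 hx'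
  exact absurd ((G.mono 0 m (Nat.zero_le m) hm).trans hx) (not_le.2 hb)

lemma virtualBid_mono : Monotone (virtualBid (gridMeasure k q v)) := by
  intro b b' hbb
  rcases lt_or_ge b (v 0) with hb | hb
  · rw [G.virtualBid_of_lt hb]; exact bot_le
  · obtain ⟨l, hl, h⟩ := G.exists_level hb
    obtain ⟨l', hl', h'⟩ := G.exists_level (hb.trans hbb)
    rw [G.virtualBid_eq hl h, G.virtualBid_eq hl' h', EReal.coe_le_coe_iff]
    exact G.levelValue_mono ((h' l hl).1 (((h l hl).2 le_rfl).trans hbb)) hl'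

/-! ### The positive part of the virtual bid -/

omit G in
lemma positiveValue_eq {b : ℝ} {l : ℕ} (hl : l ≤ k) (h : ∀ m ≤ k, v m ≤ b ↔ m ≤ l) :
    positiveValue k q v b = max (levelValue q v l) 0 := by
  rw [positiveValue, ← sum_levelIncrement, ← Finset.sum_filter]
  refine Finset.sum_congr ?_ fun _ _ => rfl
  ext m
  simp only [Finset.mem_filter, Finset.mem_range]
  constructor
  · rintro ⟨hm, hv⟩
    have := (h m (by omega)).1 hv
    omega
  · intro hm
    exact ⟨by omega, (h m (by omega)).2 (by omega)⟩

lemma positiveValue_of_lt {b : ℝ} (hb : b < v 0) : positiveValue k q v b = 0 :=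
  Finset.sum_eq_zero fun m hm => if_neg (not_le.2 (hb.trans_le
    (G.mono 0 m (Nat.zero_le m) (Nat.lt_succ_iff.1 (Finset.mem_range.1 hm)))))

lemma positiveValue_nonneg (b : ℝ) : 0 ≤ positiveValue k q v b :=
  Finset.sum_nonneg fun m hm => by
    split_ifs
    · exact G.levelIncrement_nonneg (Nat.lt_succ_iff.1 (Finset.mem_range.1 hm))
    · exact le_rfl

lemma positiveValue_le (b : ℝ) : positiveValue k q v b ≤ v k := by
  rcases lt_or_ge b (v 0) with hb | hb
  · rw [G.positiveValue_of_lt hb]; exact G.nonneg k le_rfl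
  · obtain ⟨l, hl, h⟩ := G.exists_level hb
    rw [positiveValue_eq hl h]
    exact max_le ((G.levelValue_le hl).trans (G.mono _ _ hl le_rfl)) (G.nonneg k le_rfl)

lemma positiveValue_of_last_le {b : ℝ} (hb : v k ≤ b) : positiveValue k q v b = v k := by
  rw [positiveValue_eq le_rfl fun m hm => ⟨fun _ => hm, fun _ => (G.mono _ _ hm le_rfl).trans hb⟩,
    G.levelValue_last, max_eq_left (G.nonneg k le_rfl)]

/-- `positiveValue` is the positive part of the virtual bid. -/
lemma positiveValue_eq_of_nonneg {b : ℝ} (h : 0 ≤ virtualBid (gridMeasure k q v) b) :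
    (positiveValue k q v b : EReal) = virtualBid (gridMeasure k q v) b := by
  rcases lt_or_ge b (v 0) with hb | hb
  · rw [G.virtualBid_of_lt hb] at h
    simp at h
  · obtain ⟨l, hl, hlv⟩ := G.exists_level hb
    rw [G.virtualBid_eq hl hlv] at h ⊢
    rw [positiveValue_eq hl hlv, max_eq_left (by exact_mod_cast h)]

lemma positiveValue_eq_zero_of_neg {b : ℝ} (h : virtualBid (gridMeasure k q v) b < 0) :
    positiveValue k q v b = 0 := by
  rcases lt_or_ge b (v 0) with hb | hb
  · exact G.positiveValue_of_lt hb
  · obtain ⟨l, hl, hlv⟩ := G.exists_level hb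
    rw [G.virtualBid_eq hl hlv] at h
    rw [positiveValue_eq hl hlv, max_eq_right (by exact_mod_cast h.le)]

omit G in
lemma measurable_positiveValue : Measurable (positiveValue k q v) :=
  Finset.measurable_sum _ fun _ _ =>
    Measurable.ite (measurableSet_le measurable_const measurable_id) measurable_const
      measurable_const

end RevenueGrid

/-! ## Myerson's mechanism -/

section Myerson

variable {n : ℕ} {D : Fin n → Measure ℝ}

lemma myersonWins_unique {b : Fin n → ℝ} {i j : Fin n} (hi : myersonWins D b i)
    (hj : myersonWins D b j) : i = j := by
  by_contra hne
  rcases hi.2 j (Ne.symm hne) with h | ⟨h, hlt⟩ <;> rcases hj.2 i hne with h' | ⟨h', hlt'⟩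
  · exact lt_asymm h h'
  · exact h.ne h'.symm
  · exact h'.ne h.symm
  · exact lt_asymm hlt hlt'

lemma myerson_alloc_nonneg (b : Fin n → ℝ) (i : Fin n) : 0 ≤ (myerson D).alloc b i := by
  simp only [myerson]
  split_ifs <;> norm_num

lemma myerson_isFeasible : (myerson D).IsFeasible := by
  classical
  refine fun b => ⟨myerson_alloc_nonneg b, ?_⟩
  have h0 : ∀ i, ¬ myersonWins D b i → (myerson D).alloc b i = 0 := fun i hi => if_neg hi
  by_cases h : ∃ i, myersonWins D b i
  · obtain ⟨i, hi⟩ := h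
    rw [Finset.sum_eq_single i (fun j _ hj => h0 j fun h => hj (myersonWins_unique h hi))
      (by simp)]
    exact (if_pos hi).le
  · push Not at h
    rw [Finset.sum_eq_zero fun i _ => h0 i (h i)]
    exact zero_le_one

lemma myersonWins_update_iff {b : Fin n → ℝ} {i : Fin n} {z : ℝ} :
    myersonWins D (Function.update b i z) i ↔ 0 ≤ virtualBid (D i) z ∧ ∀ j, j ≠ i →
      virtualBid (D j) (b j) < virtualBid (D i) z ∨
        (virtualBid (D j) (b j) = virtualBid (D i) z ∧ i < j) := by
  simp only [myersonWins, Function.update_self]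
  refine and_congr Iff.rfl (forall_congr' fun j => imp_congr_right fun hj => ?_)
  rw [Function.update_of_ne hj]

lemma myersonWins_update_of_le {b : Fin n → ℝ} {i : Fin n} {z z' : ℝ}
    (h : virtualBid (D i) z ≤ virtualBid (D i) z')
    (hz : myersonWins D (Function.update b i z) i) :
    myersonWins D (Function.update b i z') i := by
  rw [myersonWins_update_iff] at hz ⊢
  refine ⟨hz.1.trans h, fun j hj => ?_⟩
  rcases hz.2 j hj with h1 | ⟨h1, h2⟩
  · exact Or.inl (h1.trans_le h)
  · rw [h1]
    exact h.lt_or_eq.imp id fun h => ⟨h, h2⟩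

/-- If the highest virtual bid is nonnegative, some bidder wins, and her virtual bid is highest. -/
lemma exists_myersonWins {b : Fin n → ℝ} (h : ∃ i, 0 ≤ virtualBid (D i) (b i)) :
    ∃ i, myersonWins D b i ∧ ∀ j, virtualBid (D j) (b j) ≤ virtualBid (D i) (b i) := by
  classical
  obtain ⟨i₀, hi₀⟩ := h
  have : Nonempty (Fin n) := ⟨i₀⟩
  have hex : ∃ i, ∀ j, virtualBid (D j) (b j) ≤ virtualBid (D i) (b i) :=
    Finite.exists_max fun i => virtualBid (D i) (b i)
  let S : Finset (Fin n) :=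
    Finset.univ.filter fun i => ∀ j, virtualBid (D j) (b j) ≤ virtualBid (D i) (b i)
  have hS : S.Nonempty := by
    obtain ⟨i, hi⟩ := hex
    exact ⟨i, by simpa [S] using hi⟩
  have hm : ∀ j, virtualBid (D j) (b j) ≤ virtualBid (D (S.min' hS)) (b (S.min' hS)) := by
    have := S.min'_mem hS
    simpa [S] using this
  refine ⟨S.min' hS, ⟨hi₀.trans (hm i₀), fun j hj => ?_⟩, hm⟩
  refine (hm j).lt_or_eq.imp id fun h => ⟨h, ?_⟩
  refine lt_of_le_of_ne (S.min'_le j ?_) (Ne.symm hj)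
  simp only [S, Finset.mem_filter, Finset.mem_univ, true_and]
  exact fun j' => h ▸ hm j'

/-- The bids with which bidder `i` wins form a half-line `[θ, ∞)`, or she never wins. -/
def HasThresholds (D : Fin n → Measure ℝ) : Prop :=
  ∀ (b : Fin n → ℝ) (i : Fin n), (∀ z, ¬ myersonWins D (Function.update b i z) i) ∨
    ∃ θ, 0 ≤ θ ∧ ∀ z, myersonWins D (Function.update b i z) i ↔ θ ≤ z

lemma myerson_alloc_of_forall_not {b : Fin n → ℝ} {i : Fin n}
    (h : ∀ z, ¬ myersonWins D (Function.update b i z) i) (z : ℝ) :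
    (myerson D).alloc (Function.update b i z) i = 0 ∧
      (myerson D).pay (Function.update b i z) i = 0 :=
  ⟨if_neg (h z), if_neg (h z)⟩

open Classical in
lemma myerson_alloc_of_threshold {b : Fin n → ℝ} {i : Fin n} {θ : ℝ} (hθ : 0 ≤ θ)
    (h : ∀ z, myersonWins D (Function.update b i z) i ↔ θ ≤ z) (z : ℝ) :
    (myerson D).alloc (Function.update b i z) i = (if θ ≤ z then 1 else 0) ∧
      (myerson D).pay (Function.update b i z) i = if θ ≤ z then θ else 0 := by
  have hinf : sInf {z : ℝ | 0 ≤ z ∧ θ ≤ z} = θ :=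
    IsLeast.csInf_eq ⟨⟨hθ, le_rfl⟩, fun x hx => hx.2⟩
  simp only [myerson, Function.update_idem, h, hinf]
  constructor <;> trivial

lemma myerson_isDSIC (hD : HasThresholds D) : (myerson D).IsDSIC := by
  intro i b _ w _
  have hb : (myerson D).utility i (b i) b
      = (myerson D).utility i (b i) (Function.update b i (b i)) := by
    rw [Function.update_eq_self]
  rw [hb]
  simp only [Mechanism.utility]
  rcases hD b i with h | ⟨θ, hθ, h⟩
  · rw [(myerson_alloc_of_forall_not h _).1, (myerson_alloc_of_forall_not h _).2,
      (myerson_alloc_of_forall_not h _).1, (myerson_alloc_of_forall_not h _).2]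
  · rw [(myerson_alloc_of_threshold hθ h _).1, (myerson_alloc_of_threshold hθ h _).2,
      (myerson_alloc_of_threshold hθ h _).1, (myerson_alloc_of_threshold hθ h _).2]
    split_ifs <;> linarith

lemma myerson_isExPostIR (hD : HasThresholds D) : (myerson D).IsExPostIR := by
  intro i b _
  have hb : (myerson D).utility i (b i) b
      = (myerson D).utility i (b i) (Function.update b i (b i)) := by
    rw [Function.update_eq_self]
  rw [hb]
  simp only [Mechanism.utility]
  rcases hD b i with h | ⟨θ, hθ, h⟩
  · rw [(myerson_alloc_of_forall_not h _).1, (myerson_alloc_of_forall_not h _).2]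
    simp
  · rw [(myerson_alloc_of_threshold hθ h _).1, (myerson_alloc_of_threshold hθ h _).2]
    split_ifs <;> linarith

lemma measurableSet_myersonWins (hD : ∀ i, Measurable (virtualBid (D i))) (i : Fin n) :
    MeasurableSet {b | myersonWins D b i} := by
  have hm : ∀ j, Measurable fun b : Fin n → ℝ => virtualBid (D j) (b j) :=
    fun j => (hD j).comp (measurable_pi_apply j)
  have : {b | myersonWins D b i} = {b | 0 ≤ virtualBid (D i) (b i)} ∩ ⋂ j, {b | j ≠ i →
      virtualBid (D j) (b j) < virtualBid (D i) (b i) ∨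
        (virtualBid (D j) (b j) = virtualBid (D i) (b i) ∧ i < j)} := by
    ext b
    simp [myersonWins]
  rw [this]
  refine (measurableSet_le measurable_const (hm i)).inter (MeasurableSet.iInter fun j => ?_)
  by_cases hj : j ≠ i
  · simp only [hj, ne_eq, not_false_eq_true, forall_true_left]
    refine (measurableSet_lt (hm j) (hm i)).union ((measurableSet_eq_fun (hm j) (hm i)).inter ?_)
    exact MeasurableSet.const _
  · simp [hj]

lemma measurable_myerson_alloc (hD : ∀ i, Measurable (virtualBid (D i))) (i : Fin n) :
    Measurable fun b => (myerson D).alloc b i :=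
  Measurable.ite (measurableSet_myersonWins hD i) measurable_const measurable_const

end Myerson

/-! ## Myerson's mechanism on grids -/

section MyersonGrid

variable {n k : ℕ} {q : ℕ → ℝ} {v : Fin n → ℕ → ℝ} (G : ∀ i, RevenueGrid k q (v i))
include G

/-- Thresholds are grid values with nonnegative virtual value. -/
lemma RevenueGrid.exists_threshold (b : Fin n → ℝ) (i : Fin n) :
    (∀ z, ¬ myersonWins (fun i => gridMeasure k q (v i)) (Function.update b i z) i) ∨
    ∃ l ≤ k, 0 ≤ levelValue q (v i) l ∧
      ∀ z, myersonWins (fun i => gridMeasure k q (v i)) (Function.update b i z) i ↔ v i l ≤ z := by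
  classical
  set D := fun i => gridMeasure k q (v i) with hD
  by_cases hex : ∃ z, myersonWins D (Function.update b i z) i
  swap
  · push Not at hex
    exact Or.inl hex
  refine Or.inr ?_
  -- Rounding a winning bid down to the grid keeps its virtual bid, so it still wins. Hence the
  -- least winning level is the threshold.
  have hround : ∀ z, myersonWins D (Function.update b i z) i → ∃ l ≤ k, v i l ≤ z ∧
      0 ≤ levelValue q (v i) l ∧ myersonWins D (Function.update b i (v i l)) i := by
    intro z hz
    have hz0 : 0 ≤ virtualBid (D i) z := (myersonWins_update_iff.1 hz).1
    have hvz : v i 0 ≤ z := by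
      by_contra! h
      rw [hD] at hz0
      simp [(G i).virtualBid_of_lt h] at hz0
    obtain ⟨l, hl, h⟩ := (G i).exists_level hvz
    have hlz := (h l hl).2 le_rfl
    have e := (G i).virtualBid_eq hl h
    have e' := (G i).virtualBid_eq (b := v i l) hl
      fun m hm => ⟨fun hml => (h m hm).1 (hml.trans hlz), fun hml => (G i).mono _ _ hml hl⟩
    refine ⟨l, hl, hlz, ?_, myersonWins_update_of_le (by rw [hD]; exact (e.trans e'.symm).le) hz⟩
    rw [hD] at hz0
    simp only [e] at hz0
    exact_mod_cast hz0
  have hP : ∃ l, l ≤ k ∧ 0 ≤ levelValue q (v i) l ∧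
      myersonWins D (Function.update b i (v i l)) i := by
    obtain ⟨z, hz⟩ := hex
    obtain ⟨l, hl, -, h⟩ := hround z hz
    exact ⟨l, hl, h⟩
  obtain ⟨hl, hl0, hlw⟩ := Nat.find_spec hP
  refine ⟨Nat.find hP, hl, hl0, fun z => ⟨fun hz => ?_, fun hz =>
    myersonWins_update_of_le ((G i).virtualBid_mono hz) hlw⟩⟩
  obtain ⟨l, hlk, hlz, h⟩ := hround z hz
  exact ((G i).mono _ _ (Nat.find_min' hP ⟨hlk, h⟩) hlk).trans hlz

lemma RevenueGrid.hasThresholds : HasThresholds fun i => gridMeasure k q (v i) := by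
  intro b i
  rcases RevenueGrid.exists_threshold G b i with h | ⟨l, hl, -, h⟩
  · exact Or.inl h
  · exact Or.inr ⟨v i l, (G i).nonneg l hl, h⟩

lemma RevenueGrid.measurable_virtualBid (i : Fin n) :
    Measurable (virtualBid (gridMeasure k q (v i))) :=
  (G i).virtualBid_mono.measurable

lemma RevenueGrid.pay_mem_Icc (b : Fin n → ℝ) (i : Fin n) :
    (myerson fun i => gridMeasure k q (v i)).pay b i ∈ Icc 0 (v i k) := by
  have h0 := (G i).nonneg k le_rfl
  rw [← Function.update_eq_self i b]
  rcases RevenueGrid.exists_threshold G b i with h | ⟨l, hl, -, h⟩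
  · rw [(myerson_alloc_of_forall_not h _).2]
    exact ⟨le_rfl, h0⟩
  · rw [(myerson_alloc_of_threshold ((G i).nonneg l hl) h _).2]
    split_ifs
    · exact ⟨(G i).nonneg l hl, (G i).mono _ _ hl le_rfl⟩
    · exact ⟨le_rfl, h0⟩

open Classical in
lemma RevenueGrid.measurable_pay (i : Fin n) :
    Measurable fun b => (myerson fun i => gridMeasure k q (v i)).pay b i := by
  set D := fun i => gridMeasure k q (v i) with hD
  have hw := measurableSet_myersonWins (D := D) (RevenueGrid.measurable_virtualBid G)
  have hwz : ∀ z, MeasurableSet {b | myersonWins D (Function.update b i z) i} := fun z =>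
    (measurable_update'.comp (measurable_id.prodMk measurable_const)) (hw i)
  -- The infimum defining the payment is replaced by a finite sum: the lowest grid value plus the
  -- gaps above all levels at which the bidder would still lose.
  have key : (fun b => (myerson D).pay b i) = fun b => if myersonWins D b i then v i 0 +
      ∑ l ∈ Finset.range k, (if myersonWins D (Function.update b i (v i l)) i then 0
        else v i (l + 1) - v i l) else 0 := by
    funext b
    have hb : (myerson D).pay b i = (myerson D).pay (Function.update b i (b i)) i := by
      rw [Function.update_eq_self]
    by_cases hbw : myersonWins D b i
    swap
    · rw [if_neg hbw]; exact if_neg hbw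
    rw [if_pos hbw, hb]
    rw [← Function.update_eq_self i b] at hbw
    rcases RevenueGrid.exists_threshold G b i with h | ⟨l, hl, -, h⟩
    · exact absurd hbw (h _)
    · rw [(myerson_alloc_of_threshold ((G i).nonneg l hl) h _).2, if_pos ((h _).1 hbw)]
      simp only [hD, h]
      have : ∀ m ≤ k, ∑ j ∈ Finset.range m, (if v i l ≤ v i j then 0 else v i (j + 1) - v i j)
          = min (v i m) (v i l) - v i 0 := by
        intro m
        induction m with
        | zero =>
          intro _
          simp [min_eq_left ((G i).mono 0 l (Nat.zero_le l) hl)]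
        | succ m ih =>
          intro hm
          rw [Finset.sum_range_succ, ih (by omega)]
          have h1 := (G i).mono m (m + 1) (Nat.le_succ m) hm
          split_ifs with hlm
          · rw [min_eq_right hlm, min_eq_right (hlm.trans h1)]; ring
          · have hml : m + 1 ≤ l := by
              by_contra! hlt
              exact hlm ((G i).mono _ _ (by omega) (by omega))
            rw [min_eq_left ((G i).mono _ _ hml hl), min_eq_left (not_le.1 hlm).le]; ring
      rw [this k le_rfl, min_eq_right ((G i).mono _ _ hl le_rfl)]; ring
  rw [key]
  refine Measurable.ite (hw i) (measurable_const.add (Finset.measurable_sum _ fun l _ =>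
    Measurable.ite (hwz _) measurable_const measurable_const)) measurable_const

lemma RevenueGrid.integrable_pay (P : Measure (Fin n → ℝ)) [IsFiniteMeasure P] (i : Fin n) :
    Integrable (fun b => (myerson fun i => gridMeasure k q (v i)).pay b i) P := by
  refine Integrable.of_bound (RevenueGrid.measurable_pay G i).aestronglyMeasurable (v i k)
    (ae_of_all _ fun b => ?_)
  have := RevenueGrid.pay_mem_Icc G b i
  rw [Real.norm_eq_abs, abs_of_nonneg this.1]
  exact this.2

/-- The winner's virtual value is at least the positive part of everyone's virtual value. -/
lemma RevenueGrid.positiveValue_le_sum (b : Fin n → ℝ) (j : Fin n) :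
    positiveValue k q (v j) (b j) ≤ ∑ i, (myerson fun i => gridMeasure k q (v i)).alloc b i *
      positiveValue k q (v i) (b i) := by
  set D := fun i => gridMeasure k q (v i) with hD
  have hnn : ∀ i, 0 ≤ (myerson D).alloc b i * positiveValue k q (v i) (b i) := fun i =>
    mul_nonneg (myerson_alloc_nonneg b i) ((G i).positiveValue_nonneg _)
  rcases lt_or_ge (virtualBid (D j) (b j)) 0 with h | h
  · rw [(G j).positiveValue_eq_zero_of_neg h]
    exact Finset.sum_nonneg fun i _ => hnn i
  · obtain ⟨i, hi, hmax⟩ := exists_myersonWins (D := D) ⟨j, h⟩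
    refine le_trans ?_ (Finset.single_le_sum (fun i _ => hnn i) (Finset.mem_univ i))
    have ha : (myerson D).alloc b i = 1 := if_pos hi
    rw [ha, one_mul, ← EReal.coe_le_coe_iff, (G j).positiveValue_eq_of_nonneg h,
      (G i).positiveValue_eq_of_nonneg hi.1]
    exact hmax j

end MyersonGrid

/-! ## Resampling one coordinate of a product measure -/

section Resample

variable {n : ℕ} (D : Fin n → Measure ℝ) [∀ i, IsProbabilityMeasure (D i)]

/-- Redrawing one coordinate independently keeps the product law, as is checked on boxes. With
Fubini this allows conditioning on the other bids, or on one bidder's own type. -/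
lemma measurePreserving_update (i : Fin n) :
    MeasurePreserving (fun p : (Fin n → ℝ) × ℝ => Function.update p.1 i p.2)
      ((Measure.pi D).prod (D i)) (Measure.pi D) := by
  classical
  refine ⟨measurable_update', (Measure.pi_eq fun s hs => ?_).symm⟩
  rw [Measure.map_apply measurable_update' (MeasurableSet.univ_pi hs)]
  have : (fun p : (Fin n → ℝ) × ℝ => Function.update p.1 i p.2) ⁻¹' univ.pi s
      = (univ.pi (Function.update s i univ)) ×ˢ s i := by
    ext ⟨v, t⟩
    simp only [mem_preimage, mem_univ_pi, mem_prod]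
    constructor
    · refine fun h => ⟨fun j => ?_, by simpa using h i⟩
      by_cases hj : j = i
      · subst hj; simp
      · simpa [hj] using h j
    · rintro ⟨h, ht⟩ j
      by_cases hj : j = i
      · subst hj; simpa using ht
      · simpa [hj] using h j
  rw [this, Measure.prod_prod, Measure.pi_pi,
    ← Finset.mul_prod_erase Finset.univ _ (Finset.mem_univ i),
    ← Finset.mul_prod_erase Finset.univ (fun j => D j (s j)) (Finset.mem_univ i),
    Function.update_self, measure_univ, one_mul, mul_comm]
  congr 1
  refine Finset.prod_congr rfl fun j hj => ?_
  rw [Function.update_of_ne (Finset.ne_of_mem_erase hj)]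

variable {D}

lemma integrable_resample {F : (Fin n → ℝ) → ℝ} (hF : Integrable F (Measure.pi D)) (i : Fin n) :
    Integrable (fun p : (Fin n → ℝ) × ℝ => F (Function.update p.1 i p.2))
      ((Measure.pi D).prod (D i)) :=
  (measurePreserving_update D i).integrable_comp_of_integrable hF

lemma integral_resample {F : (Fin n → ℝ) → ℝ} (hF : Integrable F (Measure.pi D)) (i : Fin n) :
    ∫ p : (Fin n → ℝ) × ℝ, F (Function.update p.1 i p.2) ∂(Measure.pi D).prod (D i)
      = ∫ v, F v ∂Measure.pi D := by
  have h := measurePreserving_update D i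
  rw [← h.map_eq] at hF
  conv_rhs => rw [← h.map_eq]
  exact (integral_map h.measurable.aemeasurable hF.aestronglyMeasurable).symm

lemma integral_pi_eq_left {F : (Fin n → ℝ) → ℝ} (hF : Integrable F (Measure.pi D)) (i : Fin n) :
    ∫ v, F v ∂Measure.pi D = ∫ v, ∫ t, F (Function.update v i t) ∂D i ∂Measure.pi D := by
  rw [← integral_resample hF i, integral_prod _ (integrable_resample hF i)]

lemma integral_pi_eq_right {F : (Fin n → ℝ) → ℝ} (hF : Integrable F (Measure.pi D)) (i : Fin n) :
    ∫ v, F v ∂Measure.pi D = ∫ t, ∫ v, F (Function.update v i t) ∂Measure.pi D ∂D i := by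
  rw [← integral_resample hF i, integral_prod_symm _ (integrable_resample hF i)]

lemma integral_mul_of_indep {f : ℝ → ℝ} {g : (Fin n → ℝ) → ℝ} {i : Fin n}
    (hg : ∀ v t, g (Function.update v i t) = g v)
    (hfg : Integrable (fun v => f (v i) * g v) (Measure.pi D)) :
    ∫ v, f (v i) * g v ∂Measure.pi D = (∫ t, f t ∂D i) * ∫ v, g v ∂Measure.pi D := by
  rw [integral_pi_eq_right hfg i]
  simp only [Function.update_self, hg, integral_const_mul, integral_mul_const]

end Resample

/-! ## Virtual values against survival probabilities -/

-- Layer cake: `positiveValue` is a sum of steps starting at the grid values, and each layer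
-- contributes its height times the survival at the larger of its start and c.
open Classical in
lemma setIntegral_positiveValue (μ : Measure ℝ) [IsFiniteMeasure μ] (k : ℕ) (q v : ℕ → ℝ)
    (c : ℝ) : ∫ t in Ici c, positiveValue k q v t ∂μ
      = ∑ l ∈ Finset.range (k + 1), levelIncrement q v l * survival μ (max (v l) c) := by
  have hm : ∀ l, MeasurableSet {t : ℝ | v l ≤ t} := fun l => measurableSet_Ici
  simp only [positiveValue]
  have hi : ∀ l : ℕ, (fun t => if v l ≤ t then levelIncrement q v l else 0)
      = (Ici (v l)).indicator fun _ => levelIncrement q v l := fun l => by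
    ext t; simp [indicator]
  rw [integral_finsetSum]
  · refine Finset.sum_congr rfl fun l _ => ?_
    rw [hi, integral_indicator measurableSet_Ici, Measure.restrict_restrict measurableSet_Ici,
      setIntegral_const, Ici_inter_Ici, smul_eq_mul, mul_comm]
    rfl
  · intro l _
    rw [hi]
    exact (integrable_const _).indicator measurableSet_Ici

lemma RevenueGrid.integrable_positiveValue {k : ℕ} {q v : ℕ → ℝ} (G : RevenueGrid k q v)
    (μ : Measure ℝ) [IsFiniteMeasure μ] : Integrable (positiveValue k q v) μ := by
  refine Integrable.of_bound RevenueGrid.measurable_positiveValue.aestronglyMeasurable (v k)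
    (ae_of_all _ fun t => ?_)
  rw [Real.norm_eq_abs, abs_of_nonneg (G.positiveValue_nonneg t)]
  exact G.positiveValue_le t

namespace RevenueGrid

variable {k : ℕ} {q v : ℕ → ℝ} (G : RevenueGrid k q v)
include G

omit G in
lemma sum_levelIncrement_mul_last :
    ∑ l ∈ Finset.range (k + 1), levelIncrement q v l * q (max l k)
      = max (levelValue q v k) 0 * q k := by
  rw [← sum_levelIncrement, Finset.sum_mul]
  refine Finset.sum_congr rfl fun l hl => ?_
  rw [max_eq_right (Nat.lt_succ_iff.1 (Finset.mem_range.1 hl))]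

-- Moving from j + 1 to j alters only the terms with l ≤ j, whose increments add up to the positive
-- part of the slope at j. Iterated, this is summation by parts.
omit G in
lemma sum_levelIncrement_mul_succ {j : ℕ} (hj : j < k) :
    ∑ l ∈ Finset.range (k + 1), levelIncrement q v l * q (max l j)
      = ∑ l ∈ Finset.range (k + 1), levelIncrement q v l * q (max l (j + 1))
        + max (levelValue q v j) 0 * (q j - q (j + 1)) := by
  rw [← sub_eq_iff_eq_add', ← Finset.sum_sub_distrib, ← sum_levelIncrement, Finset.sum_mul]
  have hsub : Finset.range (j + 1) ⊆ Finset.range (k + 1) :=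
    Finset.range_subset_range.2 (by omega)
  rw [← Finset.sum_subset hsub]
  · refine Finset.sum_congr rfl fun l hl => ?_
    have hl' := Finset.mem_range.1 hl
    rw [max_eq_right (show l ≤ j by omega), max_eq_right (show l ≤ j + 1 by omega)]
    ring
  · intro l _ hl
    have hl' : j + 1 ≤ l := by simpa using hl
    rw [max_eq_left (show j ≤ l by omega), max_eq_left hl']
    ring

/-- The revenue of a grid price is at most the virtual value it collects. -/
lemma revenue_le_sum {j : ℕ} (hj : j ≤ k) :
    q j * v j ≤ ∑ l ∈ Finset.range (k + 1), levelIncrement q v l * q (max l j) := by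
  induction hj using Nat.decreasingInduction with
  | self =>
    rw [sum_levelIncrement_mul_last, G.levelValue_last, max_eq_left (G.nonneg k le_rfl), mul_comm]
  | of_succ j hj ih =>
    have h := sub_pos.2 (G.lt_succ j hj.le)
    have e : levelValue q v j * (q j - q (j + 1)) = q j * v j - q (j + 1) * v (j + 1) :=
      div_mul_cancel₀ _ h.ne'
    rw [sum_levelIncrement_mul_succ hj]
    -- The untruncated slopes times the quantile gaps telescope to the revenue; replacing them by
    -- positive parts only adds.
    nlinarith [mul_le_mul_of_nonneg_right (le_max_left (levelValue q v j) 0) h.le]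

/-- Slopes increase with the level, so all those from j on are nonnegative, truncation never acts
and the telescoping is exact. -/
lemma revenue_eq_sum {j : ℕ} (hj : j ≤ k) (h0 : 0 ≤ levelValue q v j) :
    ∑ l ∈ Finset.range (k + 1), levelIncrement q v l * q (max l j) = q j * v j := by
  induction hj using Nat.decreasingInduction with
  | self =>
    rw [sum_levelIncrement_mul_last, G.levelValue_last, max_eq_left (G.nonneg k le_rfl), mul_comm]
  | of_succ j hj ih =>
    have h := sub_pos.2 (G.lt_succ j hj.le)
    have e : levelValue q v j * (q j - q (j + 1)) = q j * v j - q (j + 1) * v (j + 1) :=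
      div_mul_cancel₀ _ h.ne'
    rw [sum_levelIncrement_mul_succ hj, max_eq_left h0, e,
      ih (h0.trans (G.levelValue_mono (Nat.le_succ j) hj))]
    ring

variable {μ : Measure ℝ} [IsProbabilityMeasure μ]

lemma max_eq {l j : ℕ} (hl : l ≤ k) (hj : j ≤ k) : max (v l) (v j) = v (max l j) := by
  rcases le_total l j with h | h
  · rw [max_eq_right h, max_eq_right (G.mono _ _ h hj)]
  · rw [max_eq_left h, max_eq_left (G.mono _ _ h hl)]

lemma setIntegral_Ici_eq {j : ℕ} (hj : j ≤ k) : ∫ t in Ici (v j), positiveValue k q v t ∂μ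
    = ∑ l ∈ Finset.range (k + 1), levelIncrement q v l * survival μ (v (max l j)) := by
  rw [setIntegral_positiveValue]
  refine Finset.sum_congr rfl fun l hl => ?_
  rw [G.max_eq (Nat.lt_succ_iff.1 (Finset.mem_range.1 hl)) hj]

lemma revenue_le_setIntegral (hS : ∀ l ≤ k, q l ≤ survival μ (v l)) {j : ℕ} (hj : j ≤ k) :
    q j * v j ≤ ∫ t in Ici (v j), positiveValue k q v t ∂μ := by
  rw [G.setIntegral_Ici_eq hj]
  refine (G.revenue_le_sum hj).trans (Finset.sum_le_sum fun l hl => ?_)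
  have hl' := Nat.lt_succ_iff.1 (Finset.mem_range.1 hl)
  exact mul_le_mul_of_nonneg_left (hS _ (max_le hl' hj)) (G.levelIncrement_nonneg hl')

/-- The virtual value collected above a grid price of nonnegative virtual value is at most
`1 + δ` times the revenue of that price. -/
lemma setIntegral_le_revenue {δ : ℝ} (hδ : 0 ≤ δ) (hS : ∀ l ≤ k, q l ≤ survival μ (v l))
    (hS' : ∀ l < k, survival μ (v (l + 1)) ≤ (1 + δ) * q (l + 1) ∨ v l = v (l + 1))
    {j : ℕ} (hj : j ≤ k) (h0 : 0 ≤ levelValue q v j) :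
    ∫ t in Ici (v j), positiveValue k q v t ∂μ ≤ (1 + δ) * (v j * survival μ (v j)) := by
  have hvS : 0 ≤ v j * survival μ (v j) := mul_nonneg (G.nonneg j hj) (survival_nonneg _ _)
  -- The bound can fail only at a repeated grid value, hence at the top one. There the virtual value
  -- is at most the price itself, so the claim is immediate.
  by_cases hjS : survival μ (v j) ≤ (1 + δ) * q j
  · have hmain : ∫ t in Ici (v j), positiveValue k q v t ∂μ ≤ (1 + δ) * (q j * v j) := by
      rw [G.setIntegral_Ici_eq hj, ← G.revenue_eq_sum hj h0, Finset.mul_sum]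
      refine Finset.sum_le_sum fun l hl => ?_
      have hl' := Nat.lt_succ_iff.1 (Finset.mem_range.1 hl)
      rw [mul_left_comm]
      rcases le_or_gt l j with hlj | hlj
      · rw [max_eq_right hlj]
        exact mul_le_mul_of_nonneg_left hjS (G.levelIncrement_nonneg hl')
      · rw [max_eq_left hlj.le]
        obtain ⟨m, rfl⟩ : ∃ m, l = m + 1 := ⟨l - 1, by omega⟩
        rcases hS' m hl' with h | h
        · exact mul_le_mul_of_nonneg_left h (G.levelIncrement_nonneg hl')
        -- Tied levels have equal slopes, so this layer has height 0.
        · have hk := G.tie m hl' h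
          rw [levelIncrement, G.levelValue_of_eq_last hl' hk,
            G.levelValue_of_eq_last (Nat.le_of_succ_le hl') (h.trans hk)]
          simp
    refine hmain.trans (mul_le_mul_of_nonneg_left ?_ (by linarith))
    rw [mul_comm]
    exact mul_le_mul_of_nonneg_left (hS j hj) (G.nonneg j hj)
  · have hvk : v j = v k := by
      cases j with
      | zero =>
        rw [G.zero] at hjS
        exact absurd ((survival_le_one μ _).trans (by linarith)) hjS
      | succ m => exact G.tie m hj ((hS' m hj).resolve_left hjS)
    calc ∫ t in Ici (v j), positiveValue k q v t ∂μ ≤ ∫ t in Ici (v j), v j ∂μ := by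
          refine integral_mono (G.integrable_positiveValue _) (integrable_const _) fun t => ?_
          simpa only [hvk] using G.positiveValue_le t
      _ = v j * survival μ (v j) := by
          rw [setIntegral_const, smul_eq_mul, mul_comm]; rfl
      _ ≤ (1 + δ) * (v j * survival μ (v j)) := by nlinarith

end RevenueGrid

/-! ## The revenue of Myerson's mechanism on the true distribution -/

section Revenue

variable {n k : ℕ} {q : ℕ → ℝ} {v : Fin n → ℕ → ℝ} (G : ∀ i, RevenueGrid k q (v i))
  (D : Fin n → Measure ℝ) [∀ i, IsProbabilityMeasure (D i)]
include G

lemma RevenueGrid.integrable_alloc_mul (i : Fin n) : Integrable (fun b =>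
    (myerson fun i => gridMeasure k q (v i)).alloc b i * positiveValue k q (v i) (b i))
      (Measure.pi D) := by
  refine Integrable.of_bound (((measurable_myerson_alloc (RevenueGrid.measurable_virtualBid G)
    i).mul (RevenueGrid.measurable_positiveValue.comp
      (measurable_pi_apply i))).aestronglyMeasurable) (v i k) (ae_of_all _ fun b => ?_)
  have h0 := myerson_alloc_nonneg (D := fun i => gridMeasure k q (v i)) b i
  have h1 : (myerson fun i => gridMeasure k q (v i)).alloc b i ≤ 1 := by
    simp only [myerson]; split_ifs <;> norm_num
  have h2 := (G i).positiveValue_nonneg (b i)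
  rw [Real.norm_eq_abs, abs_of_nonneg (mul_nonneg h0 h2)]
  exact (mul_le_of_le_one_left h2 h1).trans ((G i).positiveValue_le _)

lemma RevenueGrid.integral_alloc_mul_le {δ : ℝ} (hδ : 0 ≤ δ) (i : Fin n)
    (hS : ∀ l ≤ k, q l ≤ survival (D i) (v i l))
    (hS' : ∀ l < k, survival (D i) (v i (l + 1)) ≤ (1 + δ) * q (l + 1) ∨ v i l = v i (l + 1)) :
    ∫ b, (myerson fun i => gridMeasure k q (v i)).alloc b i * positiveValue k q (v i) (b i)
      ∂Measure.pi D
    ≤ (1 + δ) * ∫ b, (myerson fun i => gridMeasure k q (v i)).pay b i ∂Measure.pi D := by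
  classical
  have hint := RevenueGrid.integrable_alloc_mul G D i
  have hpay := RevenueGrid.integrable_pay G (Measure.pi D) i
  -- With the other bids fixed, bidder i either never wins or faces a posted grid price, so the
  -- claim reduces to `setIntegral_le_revenue`.
  rw [integral_pi_eq_left hint i, integral_pi_eq_left hpay i, ← integral_const_mul]
  refine integral_mono (integrable_resample hint i).integral_prod_left
    ((integrable_resample hpay i).integral_prod_left.const_mul _) fun b => ?_
  simp only [Function.update_self]
  rcases RevenueGrid.exists_threshold G b i with h | ⟨l, hl, hl0, h⟩
  · simp only [(myerson_alloc_of_forall_not h _).1, (myerson_alloc_of_forall_not h _).2]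
    simp
  · have hv := (G i).nonneg l hl
    simp only [(myerson_alloc_of_threshold hv h _).1, (myerson_alloc_of_threshold hv h _).2]
    have e1 : ∫ t, (if v i l ≤ t then 1 else 0) * positiveValue k q (v i) t ∂D i
        = ∫ t in Ici (v i l), positiveValue k q (v i) t ∂D i := by
      rw [← integral_indicator measurableSet_Ici]
      congr 1
      ext t
      simp [indicator]
    have e2 : ∫ t, (if v i l ≤ t then v i l else 0) ∂D i = v i l * survival (D i) (v i l) := by
      rw [show (fun t => if v i l ≤ t then v i l else 0) = (Ici (v i l)).indicator fun _ => v i l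
        by ext t; simp [indicator], integral_indicator measurableSet_Ici, setIntegral_const,
        smul_eq_mul, mul_comm]
      rfl
    rw [e1, e2]
    exact (G i).setIntegral_le_revenue hδ hS hS' hl hl0

end Revenue

/-! ## Incentive-compatible payments of a single bidder -/

/-- The increments of the allocation rule `a` along the sequence of types `u`. -/
def allocIncrement (a : ℝ → ℝ) (u : ℕ → ℝ) : ℕ → ℝ
  | 0 => a (u 0)
  | l + 1 => a (u (l + 1)) - a (u l)

lemma sum_allocIncrement (a : ℝ → ℝ) (u : ℕ → ℝ) (l : ℕ) :
    ∑ m ∈ Finset.range (l + 1), allocIncrement a u m = a (u l) := by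
  induction l with
  | zero => simp [allocIncrement]
  | succ l ih => rw [Finset.sum_range_succ, ih, allocIncrement]; ring

/-- Interim allocations in `[0, 1]` and payments that are incentive compatible and individually
rational on the set `T` of nonnegative types. -/
structure IsInterimIC (T : Set ℝ) (a p : ℝ → ℝ) : Prop where
  nonneg : ∀ t ∈ T, 0 ≤ t
  mem_Icc : ∀ t, a t ∈ Icc (0 : ℝ) 1
  truthful : ∀ t ∈ T, ∀ w ∈ T, t * a w - p w ≤ t * a t - p t
  rational : ∀ t ∈ T, 0 ≤ t * a t - p t

namespace IsInterimIC

variable {T : Set ℝ} {a p : ℝ → ℝ} (H : IsInterimIC T a p)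
include H

lemma alloc_mono {t w : ℝ} (ht : t ∈ T) (hw : w ∈ T) (h : t ≤ w) : a t ≤ a w := by
  rcases h.eq_or_lt with rfl | h
  · exact le_rfl
  · nlinarith [H.truthful t ht w hw, H.truthful w hw t ht]

variable {u : ℕ → ℝ} (huT : ∀ l, u l ∈ T) (hu : Monotone u)
include huT hu

lemma allocIncrement_nonneg (l : ℕ) : 0 ≤ allocIncrement a u l := by
  cases l with
  | zero => exact (H.mem_Icc _).1
  | succ l => exact sub_nonneg.2 (H.alloc_mono (huT _) (huT _) (hu (Nat.le_succ l)))

-- The increments at grid types below t telescope to the allocation of the last such type, which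
-- monotonicity bounds by a t.
open Classical in
lemma sum_allocIncrement_le {t : ℝ} (ht : t ∈ T) (M : ℕ) :
    ∑ m ∈ Finset.range M, (if u m ≤ t then allocIncrement a u m else 0) ≤ a t := by
  induction M with
  | zero => simpa using (H.mem_Icc t).1
  | succ M ih =>
    by_cases h : u M ≤ t
    · rw [Finset.sum_congr rfl fun m hm => if_pos ((hu (Nat.lt_succ_iff.1
        (Finset.mem_range.1 hm))).trans h), sum_allocIncrement]
      exact H.alloc_mono (huT M) ht h
    · rw [Finset.sum_range_succ, if_neg h, add_zero]
      exact ih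

-- For t between u M and u (M + 1), not gaining by imitating u M gives p t ≤ p (u M) + t (a t - a (u
-- M)); rounding t up to u (M + 1) bounds the last term by the next increment. Individual
-- rationality starts the induction.
open Classical in
lemma payment_le (M : ℕ) : ∀ t ∈ T, t ≤ u M → p t ≤ allocIncrement a u 0 * u 0 +
    ∑ m ∈ Finset.range M, if u m ≤ t then allocIncrement a u (m + 1) * u (m + 1) else 0 := by
  have hu0 : ∀ l, 0 ≤ u l := fun l => H.nonneg _ (huT l)
  have hn : ∀ m, 0 ≤ allocIncrement a u m * u m := fun m =>
    mul_nonneg (H.allocIncrement_nonneg huT hu m) (hu0 m)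
  induction M with
  | zero =>
    intro t ht htu
    have h1 := H.rational t ht
    have h2 := H.alloc_mono ht (huT 0) htu
    have h3 : t * a t ≤ u 0 * a (u 0) := mul_le_mul htu h2 (H.mem_Icc t).1 (hu0 0)
    simp only [Finset.range_zero, Finset.sum_empty, add_zero, allocIncrement]
    linarith
  | succ M ih =>
    intro t ht htu
    rw [Finset.sum_range_succ, ← add_assoc]
    by_cases h : u M ≤ t
    · have h1 := ih (u M) (huT M) le_rfl
      have e : ∀ s, u M ≤ s →
          ∑ m ∈ Finset.range M, (if u m ≤ s then allocIncrement a u (m + 1) * u (m + 1) else 0)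
            = ∑ m ∈ Finset.range M, allocIncrement a u (m + 1) * u (m + 1) := fun s hs =>
        Finset.sum_congr rfl fun m hm => if_pos ((hu (Finset.mem_range.1 hm).le).trans hs)
      rw [e _ le_rfl] at h1
      rw [e _ h, if_pos h]
      have h2 := H.truthful t ht (u M) (huT M)
      have h3 := H.alloc_mono (huT M) ht h
      have h4 := H.alloc_mono ht (huT (M + 1)) htu
      have h5 : t * (a t - a (u M)) ≤ u (M + 1) * (a (u (M + 1)) - a (u M)) :=
        mul_le_mul htu (by linarith) (by linarith) (hu0 _)
      have h6 : allocIncrement a u (M + 1) * u (M + 1)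
          = u (M + 1) * (a (u (M + 1)) - a (u M)) := by rw [allocIncrement]; ring
      linarith
    · rw [if_neg h, add_zero]
      exact ih t ht (not_le.1 h).le

/-- An upper bound on the expected payment in terms of the expected allocated "virtual value"
`h`, when the revenue `Q m * u m` of each price in a sequence exhausting the types is bounded in
terms of `h`. -/
theorem integral_payment_le {μ : Measure ℝ} [IsProbabilityMeasure μ] (hT : ∀ᵐ t ∂μ, t ∈ T)
    (hp : Integrable p μ) {h : ℝ → ℝ} (hh : Integrable h μ) (hh0 : ∀ t, 0 ≤ h t)
    (hah : Integrable (fun t => a t * h t) μ) {Q : ℕ → ℝ} {δ C : ℝ} (hδ : 0 ≤ δ) (hC : 0 ≤ C)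
    (hQ0 : Q 0 = 1) (hex : Tendsto (fun M => μ.real (Ioi (u M))) atTop (𝓝 0))
    (h1 : ∀ m, u m = u (m + 1) ∨ survival μ (u m) ≤ (1 + δ) * Q (m + 1))
    (h2 : ∀ m, Q m * u m ≤ C + ∫ t in Ici (u m), h t ∂μ ∨ ∃ l, m = l + 1 ∧ u l = u m) :
    ∫ t, p t ∂μ ≤ (1 + δ) * (C + ∫ t, a t * h t ∂μ) := by
  classical
  have hu0 : ∀ l, 0 ≤ u l := fun l => H.nonneg _ (huT l)
  have hinc := H.allocIncrement_nonneg huT hu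
  have hind : ∀ (c : ℝ) (g : ℝ → ℝ), (fun t => if c ≤ t then g t else 0) = (Ici c).indicator g :=
    fun c g => by ext t; simp [indicator]
  -- Integrating `payment_le` weights increment m + 1 by the survival at u m, at most (1 + δ) Q (m +
  -- 1) unless the increment vanishes. The initial term has weight Q 0 = 1.
  have hpart : ∀ M, ∫ t in Iic (u M), p t ∂μ
      ≤ (1 + δ) * ∑ m ∈ Finset.range (M + 1), allocIncrement a u m * (Q m * u m) := by
    intro M
    have hterm : ∀ m, Integrable
        (fun t => if u m ≤ t then allocIncrement a u (m + 1) * u (m + 1) else 0) μ := fun m => by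
      rw [hind (u m) fun _ => _]
      exact (integrable_const _).indicator measurableSet_Ici
    have hle : ∫ t in Iic (u M), p t ∂μ ≤ ∫ t, (allocIncrement a u 0 * u 0 +
        ∑ m ∈ Finset.range M,
          if u m ≤ t then allocIncrement a u (m + 1) * u (m + 1) else 0) ∂μ := by
      rw [← integral_indicator measurableSet_Iic]
      refine integral_mono_ae (hp.indicator measurableSet_Iic)
        ((integrable_const _).add (integrable_finsetSum _ fun m _ => hterm m)) ?_
      filter_upwards [hT] with t ht
      by_cases htu : t ≤ u M
      · rw [indicator_of_mem (by exact htu)]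
        exact H.payment_le huT hu M t ht htu
      · rw [indicator_of_notMem (by exact htu)]
        refine add_nonneg (mul_nonneg (hinc 0) (hu0 0)) (Finset.sum_nonneg fun m _ => ?_)
        split_ifs
        · exact mul_nonneg (hinc _) (hu0 _)
        · exact le_rfl
    refine hle.trans ?_
    rw [integral_add (integrable_const _) (integrable_finsetSum _ fun m _ => hterm m),
      integral_finsetSum _ fun m _ => hterm m, Finset.sum_range_succ', mul_add, add_comm,
      Finset.mul_sum]
    refine add_le_add (Finset.sum_le_sum fun m _ => ?_) ?_
    · rw [hind (u m) fun _ => _, integral_indicator measurableSet_Ici, setIntegral_const,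
        smul_eq_mul]
      change survival μ (u m) * _ ≤ _
      rcases h1 m with h | h
      · simp [allocIncrement, h]
      · calc survival μ (u m) * (allocIncrement a u (m + 1) * u (m + 1))
            ≤ (1 + δ) * Q (m + 1) * (allocIncrement a u (m + 1) * u (m + 1)) :=
              mul_le_mul_of_nonneg_right h (mul_nonneg (hinc _) (hu0 _))
          _ = _ := by ring
    · simp only [integral_const, probReal_univ, one_smul, hQ0, one_mul]
      nlinarith [mul_nonneg (hinc 0) (hu0 0)]
  -- Price revenues become integrals of h above u m; exchanging sum and integral turns the
  -- increments below t into at most a t, while C is weighted by a (u M) ≤ 1.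
  have hsum : ∀ M, ∑ m ∈ Finset.range (M + 1), allocIncrement a u m * (Q m * u m)
      ≤ C + ∫ t, a t * h t ∂μ := by
    intro M
    have hterm : ∀ m, Integrable (fun t => if u m ≤ t then allocIncrement a u m * h t else 0) μ :=
      fun m => by
        rw [hind (u m) fun t => _]
        exact (hh.const_mul _).indicator measurableSet_Ici
    calc ∑ m ∈ Finset.range (M + 1), allocIncrement a u m * (Q m * u m)
        ≤ ∑ m ∈ Finset.range (M + 1), allocIncrement a u m *
            (C + ∫ t in Ici (u m), h t ∂μ) := by
          refine Finset.sum_le_sum fun m _ => ?_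
          rcases h2 m with h | ⟨l, rfl, h⟩
          · exact mul_le_mul_of_nonneg_left h (hinc m)
          · simp [allocIncrement, h]
      _ = a (u M) * C + ∫ t, (∑ m ∈ Finset.range (M + 1),
            if u m ≤ t then allocIncrement a u m * h t else 0) ∂μ := by
          rw [integral_finsetSum _ fun m _ => hterm m, ← sum_allocIncrement a u M, Finset.sum_mul,
            ← Finset.sum_add_distrib]
          refine Finset.sum_congr rfl fun m _ => ?_
          rw [hind (u m) fun t => _, integral_indicator measurableSet_Ici, integral_const_mul,
            mul_add]
      _ ≤ C + ∫ t, a t * h t ∂μ := by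
          refine add_le_add (mul_le_of_le_one_left hC (H.mem_Icc _).2) (integral_mono_ae
            (integrable_finsetSum _ fun m _ => hterm m) hah ?_)
          filter_upwards [hT] with t ht
          have := mul_le_mul_of_nonneg_right (H.sum_allocIncrement_le huT hu ht (M + 1)) (hh0 t)
          rw [Finset.sum_mul] at this
          simpa only [ite_mul, zero_mul] using this
  -- The support may be unbounded, so the estimate is proved up to u M and passed to the limit.
  have hlim := tendsto_setIntegral_of_monotone (μ := μ) (f := p) (s := fun M => Iic (u M))
    (fun M => measurableSet_Iic) (fun _ _ hm => Iic_subset_Iic.2 (hu hm)) hp.integrableOn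
  have hfull : (⋃ M, Iic (u M)) =ᵐ[μ] univ := by
    rw [eventuallyEq_univ, mem_ae_iff]
    have hz : μ.real (⋃ M, Iic (u M))ᶜ ≤ 0 := ge_of_tendsto' hex fun M =>
      measureReal_mono fun t ht => by
        simp only [compl_iUnion, compl_Iic, mem_iInter] at ht
        exact ht M
    have := le_antisymm hz measureReal_nonneg
    rwa [measureReal_eq_zero_iff] at this
  rw [setIntegral_congr_set hfull, setIntegral_univ] at hlim
  exact le_of_tendsto' hlim fun M =>
    (hpart M).trans (mul_le_mul_of_nonneg_left (hsum M) (by linarith))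

end IsInterimIC

/-! ## Interim rules of a Bayesian incentive compatible mechanism -/

section Interim

variable {n : ℕ} {M : Mechanism n} {D : Fin n → Measure ℝ} [∀ i, IsProbabilityMeasure (D i)]

/-- The interim allocation probability of type `t` of bidder `i`. -/
noncomputable def Mechanism.interimAlloc (M : Mechanism n) (D : Fin n → Measure ℝ) (i : Fin n)
    (t : ℝ) : ℝ :=
  ∫ v, M.alloc (Function.update v i t) i ∂Measure.pi D

/-- The interim payment of type `t` of bidder `i`. -/
noncomputable def Mechanism.interimPay (M : Mechanism n) (D : Fin n → Measure ℝ) (i : Fin n)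
    (t : ℝ) : ℝ :=
  ∫ v, M.pay (Function.update v i t) i ∂Measure.pi D

lemma Mechanism.IsFeasible.alloc_mem_Icc (h : M.IsFeasible) (b : Fin n → ℝ) (i : Fin n) :
    M.alloc b i ∈ Icc (0 : ℝ) 1 :=
  ⟨(h b).1 i, (Finset.single_le_sum (fun j _ => (h b).1 j) (Finset.mem_univ i)).trans (h b).2⟩

lemma Mechanism.IsBIC.integrable_alloc_update (h : M.IsBIC D) (i : Fin n) (t : ℝ) :
    Integrable (fun v => M.alloc (Function.update v i t) i) (Measure.pi D) := by
  refine Integrable.of_bound ((h.measurable_alloc i).comp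
    (measurable_update'.comp (measurable_id.prodMk measurable_const))).aestronglyMeasurable 1
    (ae_of_all _ fun v => ?_)
  have := h.feasible.alloc_mem_Icc (Function.update v i t) i
  rw [Real.norm_eq_abs]
  exact abs_le.2 ⟨by linarith [this.1], this.2⟩

lemma Mechanism.IsBIC.interimUtility_eq (h : M.IsBIC D) {i : Fin n} (t : ℝ) {w : ℝ}
    (hw : w ∈ (D i).support) :
    M.interimUtility D i t w = t * M.interimAlloc D i w - M.interimPay D i w := by
  simp only [interimUtility, utility, interimAlloc, interimPay]
  rw [integral_sub ((h.integrable_alloc_update i w).const_mul t) (h.integrable_interim i w hw),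
    integral_const_mul]

lemma Mechanism.IsBIC.isInterimIC (h : M.IsBIC D) {i : Fin n} (h0 : D i (Iio 0) = 0) :
    IsInterimIC (D i).support (M.interimAlloc D i) (M.interimPay D i) where
  nonneg t ht := nonneg_of_mem_support h0 ht
  mem_Icc t := by
    constructor
    · exact integral_nonneg fun v => (h.feasible.alloc_mem_Icc _ i).1
    · calc M.interimAlloc D i t ≤ ∫ v, (1 : ℝ) ∂Measure.pi D :=
            integral_mono (h.integrable_alloc_update i t) (integrable_const _)
              fun v => (h.feasible.alloc_mem_Icc _ i).2
        _ = 1 := by simp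
  truthful t ht w hw := by
    rw [← h.interimUtility_eq t hw, ← h.interimUtility_eq t ht]
    exact h.truthful i t ht w hw
  rational t ht := by
    rw [← h.interimUtility_eq t ht]
    exact h.rational i t ht

lemma Mechanism.IsBIC.integrable_alloc_mul (h : M.IsBIC D) {i : Fin n} {g : ℝ → ℝ}
    (hg : Integrable g (D i)) : Integrable (fun v => M.alloc v i * g (v i)) (Measure.pi D) := by
  have hgi : Integrable (fun v : Fin n → ℝ => g (v i)) (Measure.pi D) :=
    (measurePreserving_eval D i).integrable_comp_of_integrable hg
  refine hgi.bdd_mul (c := 1) (h.measurable_alloc i).aestronglyMeasurable (ae_of_all _ fun v => ?_)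
  have := h.feasible.alloc_mem_Icc v i
  rw [Real.norm_eq_abs]
  exact abs_le.2 ⟨by linarith [this.1], this.2⟩

lemma Mechanism.IsBIC.integral_pay_le (hM : M.IsBIC D) {i : Fin n} (h0 : D i (Iio 0) = 0)
    {u : ℕ → ℝ} (huT : ∀ l, u l ∈ (D i).support) (hu : Monotone u) {h : ℝ → ℝ}
    (hh : Integrable h (D i)) (hh0 : ∀ t, 0 ≤ h t) {Q : ℕ → ℝ} {δ C : ℝ} (hδ : 0 ≤ δ)
    (hC : 0 ≤ C) (hQ0 : Q 0 = 1)
    (hex : Tendsto (fun M => (D i).real (Ioi (u M))) atTop (𝓝 0))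
    (h1 : ∀ m, u m = u (m + 1) ∨ survival (D i) (u m) ≤ (1 + δ) * Q (m + 1))
    (h2 : ∀ m, Q m * u m ≤ C + ∫ t in Ici (u m), h t ∂(D i) ∨ ∃ l, m = l + 1 ∧ u l = u m) :
    ∫ v, M.pay v i ∂Measure.pi D
      ≤ (1 + δ) * (C + ∫ v, M.alloc v i * h (v i) ∂Measure.pi D) := by
  have hah := hM.integrable_alloc_mul hh
  have e : ∀ t, ∫ v, M.alloc (Function.update v i t) i * h (Function.update v i t i)
      ∂Measure.pi D = M.interimAlloc D i t * h t := fun t => by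
    simp only [Function.update_self, Mechanism.interimAlloc, integral_mul_const]
  have hah' := (integrable_resample hah i).integral_prod_right
  rw [integral_pi_eq_right (hM.integrable_pay i) i, integral_pi_eq_right hah i]
  simp only [e] at hah' ⊢
  exact (hM.isInterimIC h0).integral_payment_le huT hu Measure.support_mem_ae
    (integrable_resample (hM.integrable_pay i) i).integral_prod_right hh hh0 hah' hδ hC hQ0 hex
    h1 h2

end Interim

/-! ## Regular distributions -/

section RegularBidder

variable {μ : Measure ℝ} [IsProbabilityMeasure μ]

/-- The quantiles of a regular distribution form a revenue grid. -/
lemma IsRegularDist.revenueGrid (hreg : IsRegularDist μ) (h0 : μ (Iio 0) = 0) {k : ℕ}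
    {q : ℕ → ℝ} (hq0 : q 0 = 1) (hlast : q (k + 1) = 0) (hlt : ∀ l ≤ k, q (l + 1) < q l) :
    RevenueGrid k q fun l => quantileOracle μ (q l) := by
  have hanti : ∀ l m, l < m → m ≤ k + 1 → q m < q l := by
    intro l m h
    induction m, h using Nat.le_induction with
    | base => exact fun hm => hlt l (by omega)
    | succ m _ ih => exact fun hm => (hlt m (by omega)).trans (ih (by omega))
  have hpos : ∀ l ≤ k, 0 < q l := fun l hl => hlast ▸ hanti l (k + 1) (by omega) le_rfl
  have hle : ∀ l ≤ k, q l ≤ 1 := fun l hl => by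
    rcases Nat.eq_zero_or_pos l with rfl | h
    · exact hq0.le
    · exact hq0 ▸ (hanti 0 l h (by omega)).le
  refine ⟨hq0, hlast, hlt, fun l hl => quantileOracle_nonneg h0 (hpos l hl) (hle l hl),
    fun l m hlm hm => ?_, fun a b c hab hbc hc => ?_, fun l hl h => ?_⟩
  · rcases hlm.eq_or_lt with rfl | hlm
    · exact le_rfl
    · exact quantileOracle_anti h0 (hpos m hm) (hle l (by omega)) (hanti l m hlm (by omega)).le
  · exact hreg.slope_anti_adjacent ⟨hpos c hc, hle c hc⟩
      ⟨hpos a (by omega), hle a (by omega)⟩ (hanti b c hbc (by omega)) (hanti a b hab (by omega))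
  · rcases (Nat.succ_le_of_lt hl).eq_or_lt with rfl | hk
    · rfl
    · exact (quantileOracle_eq_of_eq h0 hreg (hpos k le_rfl) (hanti (l + 1) k hk (by omega))
        (hlt l hl.le) (hle l hl.le) h.symm).symm

open Classical in
/-- The bids above the last grid price `v`, unless `v` is an atom of larger mass than `e`. -/
def topRegion (μ : Measure ℝ) (e v : ℝ) : Set ℝ := if survival μ v = e then Ici v else ∅

open Classical in
/-- A bound on the revenue of prices in the top region. -/
noncomputable def topRevenue (μ : Measure ℝ) (e v : ℝ) : ℝ :=
  if survival μ v = e then e * v / (1 - e) else 0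

lemma measurableSet_topRegion (μ : Measure ℝ) (e v : ℝ) : MeasurableSet (topRegion μ e v) := by
  unfold topRegion
  split_ifs
  · exact measurableSet_Ici
  · exact MeasurableSet.empty

omit [IsProbabilityMeasure μ] in
lemma measureReal_topRegion_le {e v : ℝ} (he : 0 ≤ e) : μ.real (topRegion μ e v) ≤ e := by
  unfold topRegion
  split_ifs with h
  · exact h.le
  · simpa using he

lemma topRegion_subset (μ : Measure ℝ) (e v : ℝ) : topRegion μ e v ⊆ Ici v := by
  unfold topRegion
  split_ifs
  · exact Subset.rfl
  · exact empty_subset _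

-- Up to the factor 1 - e, the tail bound is what the value v collects on the top region; this links
-- the upper bound on the optimum to the surplus of the auction.
omit [IsProbabilityMeasure μ] in
lemma topRevenue_mul {e v : ℝ} (he : e < 1) :
    topRevenue μ e v * (1 - e) = v * μ.real (topRegion μ e v) := by
  unfold topRevenue topRegion
  split_ifs with h
  · rw [div_mul_cancel₀ _ (sub_pos.2 he).ne', mul_comm]
    congr 1
    exact h.symm
  · simp

/-- The revenue of a regular bidder in a Bayesian incentive compatible mechanism. -/
lemma Mechanism.IsBIC.integral_pay_le_of_isRegularDist {n : ℕ} {M : Mechanism n}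
    {D : Fin n → Measure ℝ} [∀ i, IsProbabilityMeasure (D i)] (hM : M.IsBIC D) {i : Fin n}
    (h0 : D i (Iio 0) = 0) (hreg : IsRegularDist (D i)) {k : ℕ} {q Q : ℕ → ℝ} {δ : ℝ}
    (hδ : 0 ≤ δ) (hq : ∀ l ≤ k, Q l = q l) (hlast : q (k + 1) = 0) (hQ0 : Q 0 = 1)
    (hQpos : ∀ l, 0 < Q l) (hQ : StrictAnti Q) (hQδ : ∀ l, Q l ≤ (1 + δ) * Q (l + 1))
    (hQlim : Tendsto Q atTop (𝓝 0)) (hk : q k < 1) :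
    ∫ b, M.pay b i ∂Measure.pi D ≤ (1 + δ) *
      (topRevenue (D i) (q k) (quantileOracle (D i) (q k)) + ∫ b, M.alloc b i *
        (topRegion (D i) (q k) (quantileOracle (D i) (q k)))ᶜ.indicator
          (positiveValue k q fun l => quantileOracle (D i) (q l)) (b i) ∂Measure.pi D) := by
  have hQ1 : ∀ l, Q l ≤ 1 := fun l => hQ0 ▸ hQ.antitone (Nat.zero_le l)
  have hqlt : ∀ l ≤ k, q (l + 1) < q l := fun l hl => by
    rcases hl.eq_or_lt with rfl | hl
    · rw [hlast, ← hq l le_rfl]; exact hQpos l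
    · rw [← hq l hl.le, ← hq (l + 1) hl]; exact hQ (Nat.lt_succ_self l)
  have G := hreg.revenueGrid h0 (by rw [← hq 0 (Nat.zero_le k), hQ0]) hlast hqlt
  set μ := D i with hμ
  set v : ℕ → ℝ := fun l => quantileOracle μ (q l) with hv
  have huv : ∀ l ≤ k, quantileOracle μ (Q l) = v l := fun l hl => by rw [hv, hq l hl]
  have hvk0 : 0 ≤ v k := G.nonneg k le_rfl
  have hqk : 0 < q k := G.pos le_rfl
  have hpv := G.integrable_positiveValue μ
  have hA := measurableSet_topRegion μ (q k) (v k)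
  have hmono : Monotone fun l => quantileOracle μ (Q l) := fun l m h =>
    quantileOracle_anti h0 (hQpos m) (hQ1 l) (hQ.antitone h)
  have hS : ∀ l, Q l ≤ survival μ (quantileOracle μ (Q l)) := fun l =>
    le_survival_quantileOracle h0 (hQpos l) (hQ1 l)
  refine hM.integral_pay_le (u := fun l => quantileOracle μ (Q l)) h0
    (fun l => quantileOracle_mem_support h0 (hQpos l) (hQ1 l)) hmono
    (hpv.indicator hA.compl) (fun t => indicator_nonneg (fun t _ => G.positiveValue_nonneg t) t)
    (Q := Q) hδ ?_ hQ0 ?_ ?_ ?_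
  · unfold topRevenue
    split_ifs
    · exact div_nonneg (mul_nonneg hqk.le hvk0) (by linarith)
    · exact le_rfl
  · exact squeeze_zero (fun _ => measureReal_nonneg)
      (fun l => measureReal_Ioi_quantileOracle_le h0 (hQpos l) (hQ1 l)) hQlim
  -- Either survival at v(Q m) is exactly Q m, or v(Q m) is the top atom and the sequence no longer
  -- moves.
  · intro m
    rcases (hS m).eq_or_lt with h | h
    · exact Or.inr (h ▸ hQδ m)
    · exact Or.inl (quantileOracle_eq_of_lt_survival h0 hreg (hQpos m) (hQ1 m) (hQpos _) h
        ((hQ (Nat.lt_succ_self m)).le.trans h.le)).symm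
  · intro m
    have hrev : ∀ m ≤ k, Q m * quantileOracle μ (Q m)
        ≤ ∫ t in Ici (quantileOracle μ (Q m)), positiveValue k q v t ∂μ := fun m hm => by
      rw [huv m hm, hq m hm]
      refine G.revenue_le_setIntegral (fun l hl => ?_) hm
      have := hS l
      rwa [huv l hl, hq l hl] at this
    -- If equality fails, v k is the top atom: there are no higher prices, and neither a top region
    -- nor a constant is needed.
    by_cases hN : survival μ (v k) = q k
    · left
      have hN' : survival μ (quantileOracle μ (q k)) = q k := hN
      rw [topRevenue, if_pos hN', topRegion, if_pos hN']
      have h1e : 0 < 1 - q k := by linarith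
      have hnn : 0 ≤ ∫ t in Ici (quantileOracle μ (Q m)),
          (Ici (quantileOracle μ (q k)))ᶜ.indicator (positiveValue k q v) t ∂μ :=
        integral_nonneg fun t => indicator_nonneg (fun t _ => G.positiveValue_nonneg t) t
      rcases le_or_gt m k with hm | hm
      · refine (hrev m hm).trans ?_
        -- For queried prices, the virtual value inside the top region is at most q k * v k, which
        -- the constant covers.
        have hsplit : ∫ t in Ici (quantileOracle μ (Q m)), positiveValue k q v t ∂μ
            = ∫ t in Ici (quantileOracle μ (Q m)), (Ici (v k)).indicator (positiveValue k q v) t ∂μ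
            + ∫ t in Ici (quantileOracle μ (Q m)),
              (Ici (v k))ᶜ.indicator (positiveValue k q v) t ∂μ := by
          rw [← integral_add (hpv.indicator measurableSet_Ici).integrableOn
            (hpv.indicator measurableSet_Ici.compl).integrableOn]
          refine integral_congr_ae (ae_of_all _ fun t => ?_)
          exact (congrFun (indicator_self_add_compl (Ici (v k)) (positiveValue k q v)) t).symm
        rw [hsplit]
        refine add_le_add ?_ le_rfl
        have hi : ∀ t, 0 ≤ (Ici (v k)).indicator (positiveValue k q v) t := fun t =>
          indicator_nonneg (fun t _ => G.positiveValue_nonneg t) t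
        calc ∫ t in Ici (quantileOracle μ (Q m)), (Ici (v k)).indicator (positiveValue k q v) t ∂μ
            ≤ ∫ t, (Ici (v k)).indicator (positiveValue k q v) t ∂μ :=
              setIntegral_le_integral (hpv.indicator measurableSet_Ici) (ae_of_all _ hi)
          _ ≤ ∫ t, (Ici (v k)).indicator (fun _ => v k) t ∂μ :=
              integral_mono (hpv.indicator measurableSet_Ici)
                ((integrable_const _).indicator measurableSet_Ici)
                fun t => indicator_le_indicator (G.positiveValue_le t)
          _ = q k * v k := by
              rw [integral_indicator measurableSet_Ici, setIntegral_const, smul_eq_mul]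
              exact congrArg (· * v k) hN
          _ ≤ q k * v k / (1 - q k) := by
              rw [le_div_iff₀ h1e]
              nlinarith [mul_nonneg hqk.le hvk0]
      -- Beyond the last query the constant alone covers the revenue, by concavity.
      · refine (revenue_le_div h0 hreg (hQpos m) (hQ.antitone hm.le) (by rwa [hq k le_rfl])).trans ?_
        rw [huv k le_rfl, hq k le_rfl]
        exact le_add_of_nonneg_right hnn
    · have hN' : ¬ survival μ (quantileOracle μ (q k)) = q k := hN
      rw [topRevenue, if_neg hN', topRegion, if_neg hN']
      rcases le_or_gt m k with hm | hm
      · left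
        simpa using hrev m hm
      · right
        have hlt : q k < survival μ (v k) := lt_of_le_of_ne
          (le_survival_quantileOracle h0 hqk hk.le) (Ne.symm hN)
        have hconst : ∀ l, k ≤ l → quantileOracle μ (Q l) = v k := fun l hl =>
          quantileOracle_eq_of_lt_survival h0 hreg hqk hk.le (hQpos l) hlt
            ((hq k le_rfl ▸ hQ.antitone hl).trans hlt.le)
        exact ⟨m - 1, by omega, by rw [hconst _ (by omega), hconst _ hm.le]⟩

end RegularBidder

/-! ## Truncation at the top quantiles -/

section Truncation

variable {n : ℕ} [NeZero n]

/-- The largest of the values `h i (b i)`. -/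
noncomputable def maxValue (h : Fin n → ℝ → ℝ) (b : Fin n → ℝ) : ℝ :=
  Finset.univ.sup' Finset.univ_nonempty fun i => h i (b i)

lemma le_maxValue (h : Fin n → ℝ → ℝ) (b : Fin n → ℝ) (i : Fin n) : h i (b i) ≤ maxValue h b :=
  Finset.le_sup' (fun i => h i (b i)) (Finset.mem_univ i)

lemma maxValue_le {h : Fin n → ℝ → ℝ} {b : Fin n → ℝ} {c : ℝ} (H : ∀ i, h i (b i) ≤ c) :
    maxValue h b ≤ c :=
  Finset.sup'_le _ _ fun i _ => H i

lemma maxValue_nonneg {h : Fin n → ℝ → ℝ} (h0 : ∀ i t, 0 ≤ h i t) (b : Fin n → ℝ) :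
    0 ≤ maxValue h b :=
  (h0 0 (b 0)).trans (le_maxValue h b 0)

lemma measurable_maxValue {h : Fin n → ℝ → ℝ} (hm : ∀ i, Measurable (h i)) :
    Measurable (maxValue h) := by
  convert Finset.measurable_sup' (f := fun i (b : Fin n → ℝ) => h i (b i)) Finset.univ_nonempty
    fun i _ => (hm i).comp (measurable_pi_apply i) using 1
  ext b
  simp [maxValue, Finset.sup'_apply]

lemma integrable_maxValue {D : Fin n → Measure ℝ} [∀ i, IsProbabilityMeasure (D i)]
    {h : Fin n → ℝ → ℝ} (hm : ∀ i, Measurable (h i)) (h0 : ∀ i t, 0 ≤ h i t)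
    {V : Fin n → ℝ} (hV : ∀ i t, h i t ≤ V i) : Integrable (maxValue h) (Measure.pi D) := by
  refine Integrable.of_bound (measurable_maxValue hm).aestronglyMeasurable (∑ i, V i)
    (ae_of_all _ fun b => ?_)
  rw [Real.norm_eq_abs, abs_of_nonneg (maxValue_nonneg h0 b)]
  exact maxValue_le fun i => (hV i _).trans (Finset.single_le_sum
    (fun j _ => (h0 j 0).trans (hV j 0)) (Finset.mem_univ i))

open Classical in
/-- If `g` dominates the values `f i (b i)`, then up to the probability that two bidders are in
their top regions `A i`, it collects the value `V i` of each top region and the largest of the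
values outside the top regions. -/
lemma truncation_le {D : Fin n → Measure ℝ} [∀ i, IsProbabilityMeasure (D i)]
    {f : Fin n → ℝ → ℝ} (hfm : ∀ i, Measurable (f i)) (hf0 : ∀ i t, 0 ≤ f i t)
    {V : Fin n → ℝ} (hfV : ∀ i t, f i t ≤ V i) {A : Fin n → Set ℝ}
    (hA : ∀ i, MeasurableSet (A i)) (hfA : ∀ i, ∀ t ∈ A i, f i t = V i) {e : ℝ}
    (he : ∀ i, (D i).real (A i) ≤ e) {g : (Fin n → ℝ) → ℝ} (hg : Integrable g (Measure.pi D))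
    (hfg : ∀ b i, f i (b i) ≤ g b) :
    (1 - n * e) * (∑ i, V i * (D i).real (A i)
      + ∫ b, maxValue (fun i => (A i)ᶜ.indicator (f i)) b ∂Measure.pi D)
    ≤ ∫ b, g b ∂Measure.pi D := by
  set h : Fin n → ℝ → ℝ := fun i => (A i)ᶜ.indicator (f i) with hh
  set I : Fin n → ℝ → ℝ := fun i => (A i).indicator fun _ => 1 with hI
  have hV0 : ∀ i, 0 ≤ V i := fun i => (hf0 i 0).trans (hfV i 0)
  have hhm : ∀ i, Measurable (h i) := fun i => (hfm i).indicator (hA i).compl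
  have hh0 : ∀ i t, 0 ≤ h i t := fun i t => indicator_nonneg (fun t _ => hf0 i t) t
  have hhf : ∀ i t, h i t ≤ f i t := fun i t => indicator_le_self' (fun t _ => hf0 i t) t
  have hI0 : ∀ i t, 0 ≤ I i t := fun i t => indicator_nonneg (fun _ _ => zero_le_one) t
  have hI1 : ∀ i t, I i t ≤ 1 := fun i t => indicator_le_self' (fun _ _ => zero_le_one) t
  have hIm : ∀ i, Measurable (I i) := fun i => measurable_const.indicator (hA i)
  have hIint : ∀ i, ∫ t, I i t ∂D i = (D i).real (A i) := fun i => by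
    rw [hI, integral_indicator_const _ (hA i), smul_eq_mul, mul_one]
  have hF := integrable_maxValue (D := D) hhm hh0 (fun i t => (hhf i t).trans (hfV i t))
  have hF0 := maxValue_nonneg hh0
  have hIi : ∀ i, Integrable (fun b : Fin n → ℝ => I i (b i)) (Measure.pi D) := fun i =>
    Integrable.of_bound ((hIm i).comp (measurable_pi_apply i)).aestronglyMeasurable 1
      (ae_of_all _ fun b => by rw [Real.norm_eq_abs, abs_of_nonneg (hI0 i _)]; exact hI1 i _)
  have hImul : ∀ i {F : (Fin n → ℝ) → ℝ}, Integrable F (Measure.pi D) →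
      Integrable (fun b : Fin n → ℝ => I i (b i) * F b) (Measure.pi D) := fun i F hF =>
    hF.bdd_mul (c := 1) ((hIm i).comp (measurable_pi_apply i)).aestronglyMeasurable
      (ae_of_all _ fun b => by rw [Real.norm_eq_abs, abs_of_nonneg (hI0 i _)]; exact hI1 i _)
  have hIE : ∀ i, ∫ b : Fin n → ℝ, I i (b i) ∂Measure.pi D = (D i).real (A i) := fun i => by
    rw [← hIint i]
    have := integral_mul_of_indep (D := D) (f := I i) (g := fun _ => 1) (i := i) (fun _ _ => rfl)
      (by simpa using hIi i)
    simpa using this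
  have hα0 : ∀ i, 0 ≤ (D i).real (A i) := fun i => measureReal_nonneg
  -- pairwise collisions
  have hII : ∀ i j, j ≠ i → ∫ b : Fin n → ℝ, I i (b i) * I j (b j) ∂Measure.pi D
      ≤ (D i).real (A i) * e := fun i j hji => by
    rw [integral_mul_of_indep (D := D) (f := I i) (g := fun b => I j (b j)) (i := i)
      (fun b t => by rw [Function.update_of_ne hji]) (hImul i (hIi j)), hIint, hIE]
    exact mul_le_mul_of_nonneg_left (he j) (hα0 i)
  -- When b i lies in A i, the truncated value of i is 0, so the maximum may be taken over the
  -- others, and that maximum is independent of b i.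
  have hIF : ∀ i, ∫ b : Fin n → ℝ, I i (b i) * maxValue h b ∂Measure.pi D
      ≤ e * ∫ b, maxValue h b ∂Measure.pi D := fun i => by
    set h' : Fin n → ℝ → ℝ := fun j => if j = i then 0 else h j with hh'
    have h'0 : ∀ j t, 0 ≤ h' j t := fun j t => by
      simp only [hh']; split_ifs
      · exact le_rfl
      · exact hh0 j t
    have h'h : ∀ j t, h' j t ≤ h j t := fun j t => by
      simp only [hh']; split_ifs
      · exact hh0 j t
      · exact le_rfl
    have h'm : ∀ j, Measurable (h' j) := fun j => by
      simp only [hh']; split_ifs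
      · exact measurable_const
      · exact hhm j
    have hF' := integrable_maxValue (D := D) h'm h'0
      (fun i t => (h'h i t).trans ((hhf i t).trans (hfV i t)))
    have e1 : ∀ b : Fin n → ℝ, I i (b i) * maxValue h b ≤ I i (b i) * maxValue h' b := fun b => by
      by_cases hb : b i ∈ A i
      · refine mul_le_mul_of_nonneg_left (maxValue_le fun j => ?_) (hI0 i _)
        by_cases hj : j = i
        · subst hj
          have : h j (b j) = 0 := indicator_of_notMem (by simpa using hb) _
          rw [this]
          exact maxValue_nonneg h'0 b
        · have : h j (b j) = h' j (b j) := by simp [hh', hj]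
          rw [this]
          exact le_maxValue h' b j
      · simp [hI, hb]
    have e2 : ∀ b t, maxValue h' (Function.update b i t) = maxValue h' b := fun b t => by
      unfold maxValue
      congr 1
      ext j
      by_cases hj : j = i
      · simp [hh', hj]
      · rw [Function.update_of_ne hj]
    have hF'0 : 0 ≤ ∫ b, maxValue h' b ∂Measure.pi D := integral_nonneg (maxValue_nonneg h'0)
    calc ∫ b : Fin n → ℝ, I i (b i) * maxValue h b ∂Measure.pi D
        ≤ ∫ b : Fin n → ℝ, I i (b i) * maxValue h' b ∂Measure.pi D :=
          integral_mono (hImul i hF) (hImul i hF') e1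
      _ = (D i).real (A i) * ∫ b, maxValue h' b ∂Measure.pi D := by
          rw [integral_mul_of_indep e2 (hImul i hF'), hIint]
      _ ≤ e * ∫ b, maxValue h b ∂Measure.pi D :=
          mul_le_mul (he i) (integral_mono hF' hF fun b => maxValue_le fun j =>
            (h'h j _).trans (le_maxValue h b j)) hF'0 ((hα0 i).trans (he i))
  -- the pointwise bound
  have hpt : ∀ b : Fin n → ℝ, ∑ i, V i * (I i (b i) - ∑ j ∈ Finset.univ.erase i,
      I i (b i) * I j (b j)) + (maxValue h b - ∑ i, I i (b i) * maxValue h b) ≤ g b := by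
    intro b
    have hFg : maxValue h b ≤ g b := maxValue_le fun i => (hhf i _).trans (hfg b i)
    have hg0 : 0 ≤ g b := (hF0 b).trans hFg
    -- If i is in its top region, collision with i makes every other top term nonpositive, and
    -- likewise the outside term; what remains is at most V i = f i (b i) ≤ g b.
    by_cases hex : ∃ i, b i ∈ A i
    · obtain ⟨i, hi⟩ := hex
      have hIi1 : I i (b i) = 1 := indicator_of_mem hi _
      have h2 : maxValue h b - ∑ i, I i (b i) * maxValue h b ≤ 0 := by
        have := Finset.single_le_sum (f := fun i => I i (b i) * maxValue h b)
          (fun j _ => mul_nonneg (hI0 j _) (hF0 b)) (Finset.mem_univ i)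
        simp only [hIi1, one_mul] at this
        linarith
      have h3 : ∀ j, j ≠ i → V j * (I j (b j) - ∑ l ∈ Finset.univ.erase j,
          I j (b j) * I l (b l)) ≤ 0 := fun j hj => by
        have := Finset.single_le_sum (f := fun l => I j (b j) * I l (b l))
          (fun l _ => mul_nonneg (hI0 j _) (hI0 l _))
          (Finset.mem_erase.2 ⟨Ne.symm hj, Finset.mem_univ i⟩)
        simp only [hIi1, mul_one] at this
        exact mul_nonpos_of_nonneg_of_nonpos (hV0 j) (by linarith)
      have h4 : V i * (I i (b i) - ∑ l ∈ Finset.univ.erase i, I i (b i) * I l (b l)) ≤ V i := by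
        have := Finset.sum_nonneg (s := Finset.univ.erase i)
          (f := fun l => I i (b i) * I l (b l)) fun l _ => mul_nonneg (hI0 i _) (hI0 l _)
        rw [hIi1] at this ⊢
        nlinarith [hV0 i]
      have h5 : V i ≤ g b := hfA i _ hi ▸ hfg b i
      rw [← Finset.add_sum_erase _ _ (Finset.mem_univ i)]
      have h6 := Finset.sum_nonpos (s := Finset.univ.erase i) fun j hj =>
        h3 j (Finset.ne_of_mem_erase hj)
      linarith
    · push Not at hex
      have hz : ∀ i, I i (b i) = 0 := fun i => indicator_of_notMem (hex i) _
      simp only [hz, zero_mul, Finset.sum_const_zero, sub_zero, mul_zero, zero_add]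
      exact hFg
  have hi1 : ∀ i, Integrable (fun b : Fin n → ℝ => V i * (I i (b i) - ∑ j ∈ Finset.univ.erase i,
      I i (b i) * I j (b j))) (Measure.pi D) := fun i =>
    ((hIi i).sub (integrable_finsetSum _ fun j _ => hImul i (hIi j))).const_mul _
  have hi2 : Integrable (fun b => maxValue h b - ∑ i, I i (b i) * maxValue h b) (Measure.pi D) :=
    hF.sub (integrable_finsetSum _ fun i _ => hImul i hF)
  have hint := integral_mono ((integrable_finsetSum _ fun i _ => hi1 i).add hi2) hg hpt
  refine le_trans ?_ hint
  simp only [Pi.add_apply]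
  rw [integral_add (integrable_finsetSum _ fun i _ => hi1 i) hi2,
    integral_finsetSum _ fun i _ => hi1 i,
    integral_sub hF (integrable_finsetSum _ fun i _ => hImul i hF),
    integral_finsetSum _ fun i _ => hImul i hF, mul_add, Finset.mul_sum]
  refine add_le_add (Finset.sum_le_sum fun i _ => ?_) ?_
  · rw [integral_const_mul, integral_sub (hIi i) (integrable_finsetSum _ fun j _ => hImul i (hIi j)),
      hIE, integral_finsetSum _ fun j _ => hImul i (hIi j)]
    have h1 : ∑ j ∈ Finset.univ.erase i, ∫ b : Fin n → ℝ, I i (b i) * I j (b j) ∂Measure.pi D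
        ≤ n * ((D i).real (A i) * e) := by
      refine (Finset.sum_le_card_nsmul _ _ _ fun j hj => hII i j (Finset.ne_of_mem_erase hj)).trans ?_
      rw [nsmul_eq_mul]
      refine mul_le_mul_of_nonneg_right ?_ (mul_nonneg (hα0 i) ((hα0 i).trans (he i)))
      have := Finset.card_le_univ (Finset.univ.erase i)
      rw [Fintype.card_fin] at this
      exact_mod_cast this
    calc (1 - n * e) * (V i * (D i).real (A i))
        = V i * ((D i).real (A i) - n * ((D i).real (A i) * e)) := by ring
      _ ≤ _ := mul_le_mul_of_nonneg_left (by linarith) (hV0 i)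
  · have h1 := Finset.sum_le_card_nsmul Finset.univ _ _ fun i _ => hIF i
    rw [nsmul_eq_mul, Finset.card_univ, Fintype.card_fin] at h1
    linarith

end Truncation

/-! ## The quantile vector -/

section QuantileVector

variable {δ e : ℝ}

lemma quantileVector_zero (δ e : ℝ) : quantileVector δ e 0 = 1 := if_pos rfl

lemma quantileVector_succ_last (δ e : ℝ) :
    quantileVector δ e (quantileLevels δ e + 1) = 0 := by
  simp [quantileVector]

section

variable (hδ : 0 < δ) (he : 0 < e) (he1 : e < 1)
include hδ he he1

lemma one_le_quantileLevels : 1 ≤ quantileLevels δ e :=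
  Nat.one_le_iff_ne_zero.2 (Nat.ceil_pos.2 (Real.logb_pos (by linarith)
    ((one_lt_div he).2 he1))).ne'

-- Rounding the logarithm up keeps the first ratio q₀/q₁ at most 1 + δ.
omit he1 in
lemma one_le_mul_pow_quantileLevels : 1 ≤ e * (1 + δ) ^ quantileLevels δ e := by
  have h := Nat.le_ceil (Real.logb (1 + δ) (1 / e))
  rw [Real.logb_le_iff_le_rpow (by linarith) (by positivity), Real.rpow_natCast] at h
  change 1 / e ≤ (1 + δ) ^ quantileLevels δ e at h
  rw [div_le_iff₀ he] at h
  linarith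

/-- Rounding up by less than one keeps q₁ strictly below q₀ = 1. -/
lemma mul_pow_quantileLevels_sub_one_lt : e * (1 + δ) ^ (quantileLevels δ e - 1) < 1 := by
  have h0 : 0 ≤ Real.logb (1 + δ) (1 / e) :=
    (Real.logb_pos (by linarith) ((one_lt_div he).2 he1)).le
  have h := Nat.ceil_lt_add_one h0
  have h1 : ((quantileLevels δ e - 1 : ℕ) : ℝ) < Real.logb (1 + δ) (1 / e) := by
    rw [Nat.cast_sub (one_le_quantileLevels hδ he he1)]
    have : ((quantileLevels δ e : ℕ) : ℝ) < Real.logb (1 + δ) (1 / e) + 1 := h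
    push_cast
    linarith
  rw [Real.lt_logb_iff_rpow_lt (by linarith) (by positivity), Real.rpow_natCast,
    lt_div_iff₀ he] at h1
  linarith

lemma quantileVector_last : quantileVector δ e (quantileLevels δ e) = e := by
  have := one_le_quantileLevels hδ he he1
  rw [quantileVector, if_neg (by omega), if_pos le_rfl, Nat.sub_self, pow_zero, mul_one]

end

/-- The quantile vector continued geometrically below `e`. -/
noncomputable def extendedQuantile (δ e : ℝ) (l : ℕ) : ℝ :=
  if l = 0 then 1 else e * (1 + δ) ^ quantileLevels δ e * ((1 + δ)⁻¹) ^ l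

lemma extendedQuantile_eq (hδ : 0 < δ) {l : ℕ} (hl : l ≤ quantileLevels δ e) :
    extendedQuantile δ e l = quantileVector δ e l := by
  unfold extendedQuantile quantileVector
  split_ifs with h
  · rfl
  · have : (1 + δ) ≠ 0 := by linarith
    rw [pow_sub₀ _ this hl, inv_pow]
    ring

lemma extendedQuantile_pos (hδ : 0 < δ) (he : 0 < e) (l : ℕ) : 0 < extendedQuantile δ e l := by
  unfold extendedQuantile
  split_ifs <;> positivity

variable (hδ : 0 < δ) (he : 0 < e)
include hδ he

lemma extendedQuantile_le (l : ℕ) :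
    extendedQuantile δ e l ≤ (1 + δ) * extendedQuantile δ e (l + 1) := by
  have h1 : (1 + δ) ≠ 0 := by linarith
  cases l with
  | zero =>
    simp only [extendedQuantile, if_true, one_ne_zero, if_false, zero_add, pow_one]
    have := one_le_mul_pow_quantileLevels hδ he
    rwa [mul_comm, mul_assoc, inv_mul_cancel₀ h1, mul_one]
  | succ l =>
    simp only [extendedQuantile, Nat.add_eq_zero_iff, one_ne_zero, and_false, if_false]
    rw [pow_succ _ (l + 1)]
    field_simp
    exact le_rfl

lemma extendedQuantile_strictAnti (he1 : e < 1) : StrictAnti (extendedQuantile δ e) := by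
  refine strictAnti_nat_of_succ_lt fun l => ?_
  cases l with
  | zero =>
    have h := one_le_quantileLevels hδ he he1
    rw [extendedQuantile_eq hδ (by omega), zero_add, quantileVector, if_neg (by omega), if_pos h]
    exact mul_pow_quantileLevels_sub_one_lt hδ he he1
  | succ l =>
    simp only [extendedQuantile, Nat.add_eq_zero_iff, one_ne_zero, and_false, if_false]
    rw [pow_succ _ (l + 1), ← mul_assoc]
    exact mul_lt_of_lt_one_right (by positivity) (inv_lt_one_of_one_lt₀ (by linarith))

omit he in
lemma tendsto_extendedQuantile : Tendsto (extendedQuantile δ e) atTop (𝓝 0) := by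
  have h : Tendsto (fun l : ℕ => e * (1 + δ) ^ quantileLevels δ e * ((1 + δ)⁻¹) ^ l) atTop
      (𝓝 (e * (1 + δ) ^ quantileLevels δ e * 0)) :=
    (tendsto_pow_atTop_nhds_zero_of_lt_one (by positivity)
      (inv_lt_one_of_one_lt₀ (by linarith))).const_mul _
  rw [mul_zero] at h
  refine h.congr' ?_
  filter_upwards [eventually_gt_atTop 0] with l hl
  rw [extendedQuantile, if_neg hl.ne']

lemma quantileVector_succ_lt (he1 : e < 1) {l : ℕ} (hl : l ≤ quantileLevels δ e) :
    quantileVector δ e (l + 1) < quantileVector δ e l := by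
  rcases hl.eq_or_lt with rfl | hl
  · rw [quantileVector_succ_last, quantileVector_last hδ he he1]
    exact he
  · rw [← extendedQuantile_eq hδ hl.le, ← extendedQuantile_eq hδ hl]
    exact extendedQuantile_strictAnti hδ he he1 (Nat.lt_succ_self l)

lemma quantileVector_mem_Ioc (he1 : e < 1) {l : ℕ} (hl : l ≤ quantileLevels δ e) :
    quantileVector δ e l ∈ Ioc (0 : ℝ) 1 := by
  rw [← extendedQuantile_eq hδ hl]
  refine ⟨extendedQuantile_pos hδ he l, ?_⟩
  have := (extendedQuantile_strictAnti hδ he he1).antitone (Nat.zero_le l)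
  simpa [extendedQuantile] using this

end QuantileVector

/-! ## The approximation guarantee -/

/-- The grid sequence also evaluates the oracle at the illegitimate quantile q (k + 1) = 0, but that
value carries no mass and enters slopes only multiplied by 0. -/
lemma exec_quantileMyerson {n : ℕ} (δ e : ℝ) (D : Fin n → Measure ℝ) :
    (quantileMyerson n δ e).exec D =
      myerson fun i => gridMeasure (quantileLevels δ e) (quantileVector δ e)
        fun l => quantileOracle (D i) (quantileVector δ e l) := rfl

section Approximation

variable {n : ℕ} {δ e : ℝ} {D : Fin n → Measure ℝ} [∀ i, IsProbabilityMeasure (D i)]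
  (h0 : ∀ i, D i (Iio 0) = 0) (hreg : ∀ i, IsRegularDist (D i))
  (hδ : 0 < δ) (he : 0 < e) (he1 : e < 1)
include h0 hreg hδ he he1

lemma revenueGrid_quantileVector (i : Fin n) :
    RevenueGrid (quantileLevels δ e) (quantileVector δ e)
      fun l => quantileOracle (D i) (quantileVector δ e l) :=
  (hreg i).revenueGrid (h0 i) (quantileVector_zero δ e) (quantileVector_succ_last δ e)
    fun _ hl => quantileVector_succ_lt hδ he he1 hl

lemma quantileMyerson_revenue_nonneg : 0 ≤ ((quantileMyerson n δ e).exec D).revenue D :=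
  integral_nonneg fun b => Finset.sum_nonneg fun i _ =>
    (RevenueGrid.pay_mem_Icc (revenueGrid_quantileVector h0 hreg hδ he he1) b i).1

lemma quantileMyerson_isDSIC : ((quantileMyerson n δ e).exec D).IsDSIC := by
  have h := RevenueGrid.hasThresholds (revenueGrid_quantileVector h0 hreg hδ he he1)
  rw [exec_quantileMyerson]
  exact myerson_isDSIC h

lemma quantileMyerson_isExPostIR : ((quantileMyerson n δ e).exec D).IsExPostIR := by
  have h := RevenueGrid.hasThresholds (revenueGrid_quantileVector h0 hreg hδ he he1)
  rw [exec_quantileMyerson]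
  exact myerson_isExPostIR h

lemma quantileMyerson_integrable_pay (i : Fin n) :
    Integrable (fun b => ((quantileMyerson n δ e).exec D).pay b i) (Measure.pi D) :=
  RevenueGrid.integrable_pay (revenueGrid_quantileVector h0 hreg hδ he he1) (Measure.pi D) i

/-- The virtual surplus of the quantile Myerson mechanism is at most `1 + δ` times its revenue. -/
lemma virtualSurplus_le_revenue :
    ∫ b, ∑ i, ((quantileMyerson n δ e).exec D).alloc b i *
      positiveValue (quantileLevels δ e) (quantileVector δ e)
        (fun l => quantileOracle (D i) (quantileVector δ e l)) (b i) ∂Measure.pi D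
    ≤ (1 + δ) * ((quantileMyerson n δ e).exec D).revenue D := by
  have G := revenueGrid_quantileVector h0 hreg hδ he he1
  have hq : ∀ {l}, l ≤ quantileLevels δ e → quantileVector δ e l ∈ Ioc (0 : ℝ) 1 :=
    fun hl => quantileVector_mem_Ioc hδ he he1 hl
  rw [exec_quantileMyerson, Mechanism.revenue,
    integral_finsetSum _ fun i _ => RevenueGrid.integrable_alloc_mul G D i,
    integral_finsetSum _ fun i _ => RevenueGrid.integrable_pay G _ i, Finset.mul_sum]
  refine Finset.sum_le_sum fun i _ => RevenueGrid.integral_alloc_mul_le G D hδ.le i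
    (fun l hl => le_survival_quantileOracle (h0 i) (hq hl).1 (hq hl).2) fun l hl => ?_
  -- If survival at the next answer exceeds q l, then that answer is an atom containing the quantile
  -- q l, so the two answers tie.
  rcases le_or_gt (survival (D i) (quantileOracle (D i) (quantileVector δ e (l + 1))))
    (quantileVector δ e l) with h | h
  · left
    refine h.trans ?_
    rw [← extendedQuantile_eq hδ hl.le, ← extendedQuantile_eq hδ hl]
    exact extendedQuantile_le hδ he l
  · right
    exact quantileOracle_eq_of_lt_survival (h0 i) (hreg i) (hq hl).1 (hq hl).2 (hq hl.le).1
      ((quantileVector_succ_lt hδ he he1 hl.le).trans h) h.le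

lemma quantileMyerson_approx [NeZero n] {M : Mechanism n} (hM : M.IsBIC D) (hne : n * e ≤ 1) :
    (1 - e) * (1 - n * e) * M.revenue D
      ≤ (1 + δ) ^ 2 * ((quantileMyerson n δ e).exec D).revenue D := by
  have G := revenueGrid_quantileVector h0 hreg hδ he he1
  have hlast := quantileVector_last hδ he he1
  set k := quantileLevels δ e with hk
  set q := quantileVector δ e with hq
  set v : Fin n → ℕ → ℝ := fun i l => quantileOracle (D i) (q l) with hv
  set A : Fin n → Set ℝ := fun i => topRegion (D i) e (v i k) with hA
  set C : Fin n → ℝ := fun i => topRevenue (D i) e (v i k) with hC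
  set h : Fin n → ℝ → ℝ := fun i => (A i)ᶜ.indicator (positiveValue k q (v i)) with hh
  have hAm : ∀ i, MeasurableSet (A i) := fun i => measurableSet_topRegion _ _ _
  have hh0 : ∀ i t, 0 ≤ h i t := fun i t =>
    indicator_nonneg (fun t _ => (G i).positiveValue_nonneg t) t
  have hhm : ∀ i, Measurable (h i) := fun i =>
    RevenueGrid.measurable_positiveValue.indicator (hAm i).compl
  have hhV : ∀ i t, h i t ≤ v i k := fun i t =>
    (indicator_le_self' (fun t _ => (G i).positiveValue_nonneg t) t).trans
      ((G i).positiveValue_le t)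
  have hhi : ∀ i, Integrable (h i) (D i) := fun i =>
    ((G i).integrable_positiveValue _).indicator (hAm i).compl
  have hF := integrable_maxValue (D := D) hhm hh0 hhV
  have hupper : M.revenue D ≤ (1 + δ) * (∑ i, C i + ∫ b, maxValue h b ∂Measure.pi D) := by
    have hi : ∀ i, ∫ b, M.pay b i ∂Measure.pi D
        ≤ (1 + δ) * (C i + ∫ b, M.alloc b i * h i (b i) ∂Measure.pi D) := fun i => by
      have := hM.integral_pay_le_of_isRegularDist (i := i) (h0 i) (hreg i) (k := k) (q := q)
        (Q := extendedQuantile δ e) hδ.le (fun l hl => extendedQuantile_eq hδ hl)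
        (quantileVector_succ_last δ e) (if_pos rfl) (extendedQuantile_pos hδ he)
        (extendedQuantile_strictAnti hδ he he1) (extendedQuantile_le hδ he)
        (tendsto_extendedQuantile hδ) (by rw [hlast]; exact he1)
      have hvk : v i k = quantileOracle (D i) e := by rw [hv, ← hlast]
      simp only [hC, hh, hA, hvk]
      rwa [hlast] at this
    have hai : ∀ i, Integrable (fun b => M.alloc b i * h i (b i)) (Measure.pi D) := fun i =>
      hM.integrable_alloc_mul (hhi i)
    rw [Mechanism.revenue, integral_finsetSum _ fun i _ => hM.integrable_pay i]
    refine (Finset.sum_le_sum fun i _ => hi i).trans ?_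
    rw [← Finset.mul_sum, Finset.sum_add_distrib, ← integral_finsetSum _ fun i _ => hai i]
    refine mul_le_mul_of_nonneg_left (add_le_add le_rfl (integral_mono
      (integrable_finsetSum _ fun i _ => hai i) hF fun b => ?_)) (by linarith)
    calc ∑ i, M.alloc b i * h i (b i) ≤ ∑ i, M.alloc b i * maxValue h b :=
          Finset.sum_le_sum fun i _ =>
            mul_le_mul_of_nonneg_left (le_maxValue h b i) ((hM.feasible b).1 i)
      _ = (∑ i, M.alloc b i) * maxValue h b := by rw [Finset.sum_mul]
      _ ≤ maxValue h b :=
          mul_le_of_le_one_left (maxValue_nonneg hh0 b) (hM.feasible b).2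
  have hlower := truncation_le (D := D) (f := fun i => positiveValue k q (v i))
    (fun i => RevenueGrid.measurable_positiveValue) (fun i => (G i).positiveValue_nonneg)
    (V := fun i => v i k) (fun i => (G i).positiveValue_le) hAm
    (fun i t ht => (G i).positiveValue_of_last_le (topRegion_subset _ _ _ ht))
    (fun i => measureReal_topRegion_le he.le)
    (integrable_finsetSum _ fun i _ => RevenueGrid.integrable_alloc_mul G D i)
    (fun b j => RevenueGrid.positiveValue_le_sum G b j)
  have hsurplus := virtualSurplus_le_revenue h0 hreg hδ he he1
  rw [exec_quantileMyerson] at hsurplus ⊢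
  have hCV : (∑ i, C i) * (1 - e) = ∑ i, v i k * (D i).real (A i) := by
    rw [Finset.sum_mul]
    exact Finset.sum_congr rfl fun i _ => topRevenue_mul he1
  have hF0 : 0 ≤ ∫ b, maxValue h b ∂Measure.pi D := integral_nonneg (maxValue_nonneg hh0)
  have h1e : 0 ≤ 1 - e := by linarith
  have h1n : 0 ≤ 1 - n * e := by linarith
  set F := ∫ b, maxValue h b ∂Measure.pi D with hFdef
  calc (1 - e) * (1 - n * e) * M.revenue D
      ≤ (1 - e) * (1 - n * e) * ((1 + δ) * (∑ i, C i + F)) :=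
        mul_le_mul_of_nonneg_left hupper (mul_nonneg h1e h1n)
    _ = (1 + δ) * ((1 - n * e) * ((∑ i, C i) * (1 - e) + (1 - e) * F)) := by ring
    -- The factor 1 - e is needed only to cancel the denominators of the constants; on F it is
    -- simply dropped.
    _ ≤ (1 + δ) * ((1 - n * e) * (∑ i, v i k * (D i).real (A i) + F)) := by
        rw [hCV]
        refine mul_le_mul_of_nonneg_left (mul_le_mul_of_nonneg_left ?_ h1n) (by linarith)
        nlinarith
    _ ≤ (1 + δ) * ((1 + δ) * (myerson fun i => gridMeasure k q (v i)).revenue D) :=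
        mul_le_mul_of_nonneg_left (hlower.trans hsurplus) (by linarith)
    _ = _ := by ring

end Approximation

/-! ## Query complexity -/

lemma queryComplexity_mechanismEMR (n : ℕ) (ε : ℝ) : (mechanismEMR n ε).queryComplexity =
    n * (quantileLevels (ε / 4) (ε ^ 2 / (256 * n)) + 1) := by
  simp [QueryMechanism.queryComplexity, mechanismEMR, quantileMyerson]

/-- Bernoulli's inequality for (1 + ε/4)⁴; changing the base of the logarithm from 1 + ε/4 to 1 + ε
costs a factor 4. -/
lemma log_one_add_le_four_mul {ε : ℝ} (h : 0 ≤ ε) :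
    Real.log (1 + ε) ≤ 4 * Real.log (1 + ε / 4) := by
  have h1 : 1 + ε ≤ (1 + ε / 4) ^ 4 := by
    have := one_add_mul_le_pow (show (-2 : ℝ) ≤ ε / 4 by linarith) 4
    push_cast at this
    linarith
  calc Real.log (1 + ε) ≤ Real.log ((1 + ε / 4) ^ 4) := Real.log_le_log (by linarith) h1
    _ = 4 * Real.log (1 + ε / 4) := by rw [Real.log_pow]; norm_num

lemma queryComplexity_mechanismEMR_le {c : ℝ} (hc : 1 < c) {n : ℕ} (hn : 1 ≤ n) {ε : ℝ}
    (hε : 0 < ε) (hε1 : ε < 1) (hcn : c ≤ n / ε) :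
    ((mechanismEMR n ε).queryComplexity : ℝ) ≤
      ((4 * Real.log 256 + 2 * Real.log 2) / Real.log c + 8) *
        (n * Real.logb (1 + ε) (n / ε)) := by
  have hn' : (1 : ℝ) ≤ n := by exact_mod_cast hn
  have hc0 := Real.log_pos hc
  have hL : Real.log c ≤ Real.log (n / ε) := Real.log_le_log (by linarith) hcn
  have hε0 : 0 < Real.log (1 + ε) := Real.log_pos (by linarith)
  have hδ0 : 0 < Real.log (1 + ε / 4) := Real.log_pos (by linarith)
  have hε2 : Real.log (1 + ε) ≤ Real.log 2 := Real.log_le_log (by linarith) (by linarith)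
  have h4 := log_one_add_le_four_mul hε.le
  have h256 : 0 < Real.log 256 := Real.log_pos (by norm_num)
  -- Since n ≥ 1, the reciprocal 256 n/ε² is at most 256 (n/ε)².
  have hlog : Real.log (1 / (ε ^ 2 / (256 * n))) ≤ Real.log 256 + 2 * Real.log (n / ε) := by
    have : (2 : ℝ) * Real.log (n / ε) = Real.log ((n / ε) ^ 2) := by
      rw [Real.log_pow]; norm_num
    rw [this, ← Real.log_mul (by norm_num) (by positivity)]
    refine Real.log_le_log (by positivity) ?_
    rw [one_div_div, div_pow, ← mul_div_assoc]
    refine div_le_div_of_nonneg_right ?_ (by positivity)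
    nlinarith
  have hlog0 : 0 ≤ Real.log 256 + 2 * Real.log (n / ε) := by linarith
  have hceil : (quantileLevels (ε / 4) (ε ^ 2 / (256 * n)) : ℝ)
      ≤ Real.log (1 / (ε ^ 2 / (256 * n))) / Real.log (1 + ε / 4) + 1 := by
    refine (Nat.ceil_lt_add_one ?_).le
    refine Real.logb_nonneg (by linarith) ?_
    rw [one_div_div, le_div_iff₀ (by positivity)]
    nlinarith
  have h1 : Real.log (1 / (ε ^ 2 / (256 * n))) / Real.log (1 + ε / 4)
      ≤ 4 * (Real.log 256 + 2 * Real.log (n / ε)) / Real.log (1 + ε) := by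
    rw [div_le_div_iff₀ hδ0 hε0]
    calc _ ≤ (Real.log 256 + 2 * Real.log (n / ε)) * Real.log (1 + ε) :=
          mul_le_mul_of_nonneg_right hlog hε0.le
      _ ≤ (Real.log 256 + 2 * Real.log (n / ε)) * (4 * Real.log (1 + ε / 4)) :=
          mul_le_mul_of_nonneg_left h4 hlog0
      _ = _ := by ring
  -- This absorbs two units: one from the ceiling and one from the query q₀.
  have h2 : (2 : ℝ) ≤ 2 * Real.log 2 / Real.log (1 + ε) := by
    rw [le_div_iff₀ hε0]; linarith
  -- The remaining constants are absorbed through log (n/ε) ≥ log c > 0.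
  have h3 : 4 * Real.log 256 + 2 * Real.log 2
      ≤ (4 * Real.log 256 + 2 * Real.log 2) / Real.log c * Real.log (n / ε) := by
    rw [div_mul_eq_mul_div, le_div_iff₀ hc0]
    exact mul_le_mul_of_nonneg_left hL (by linarith)
  rw [queryComplexity_mechanismEMR]
  push_cast
  rw [mul_left_comm]
  refine mul_le_mul_of_nonneg_left ?_ (by linarith)
  calc (quantileLevels (ε / 4) (ε ^ 2 / (256 * n)) : ℝ) + 1
      ≤ 4 * (Real.log 256 + 2 * Real.log (n / ε)) / Real.log (1 + ε)
        + 2 * Real.log 2 / Real.log (1 + ε) := by linarith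
    _ = (4 * Real.log 256 + 2 * Real.log 2 + 8 * Real.log (n / ε)) / Real.log (1 + ε) := by ring
    _ ≤ (((4 * Real.log 256 + 2 * Real.log 2) / Real.log c + 8) * Real.log (n / ε))
        / Real.log (1 + ε) := div_le_div_of_nonneg_right (by linarith) hε0.le
    _ = _ := by rw [Real.logb]; ring

/-! ### Assembling the guarantee for the chosen parameters -/

theorem mainTheorem9 :
    (∀ (n : ℕ), 1 ≤ n → ∀ (ε : ℝ), 0 < ε → ε < 1 →
      (∀ i l, (mechanismEMR n ε).query i l ∈ Set.Ioc (0 : ℝ) 1) ∧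
      ∀ (D : Fin n → MeasureTheory.Measure ℝ),
        (∀ i, MeasureTheory.IsProbabilityMeasure (D i)) →
        (∀ i, D i (Set.Iio 0) = 0) →
        (∀ i, IsRegularDist (D i)) →
        ((mechanismEMR n ε).exec D).IsFeasible ∧
        ((mechanismEMR n ε).exec D).IsDSIC ∧
        ((mechanismEMR n ε).exec D).IsExPostIR ∧
        (∀ i, MeasureTheory.Integrable (fun v => ((mechanismEMR n ε).exec D).pay v i)
          (MeasureTheory.Measure.pi D)) ∧
        optBIC D / ((1 + ε : ℝ) : EReal) ≤ (((mechanismEMR n ε).exec D).revenue D : EReal)) ∧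
    (∀ c : ℝ, 1 < c → ∃ C : ℝ, 0 < C ∧
      ∀ (n : ℕ), 1 ≤ n → ∀ (ε : ℝ), 0 < ε → ε < 1 → c ≤ n / ε →
        ((mechanismEMR n ε).queryComplexity : ℝ) ≤ C * (n * Real.logb (1 + ε) (n / ε))) := by
  refine ⟨fun n hn ε hε hε1 => ?_, fun c hc => ?_⟩
  · have hn' : (1 : ℝ) ≤ n := by exact_mod_cast hn
    have hδ : 0 < ε / 4 := by linarith
    have he : 0 < ε ^ 2 / (256 * n) := by positivity
    have hne : n * (ε ^ 2 / (256 * n)) = ε ^ 2 / 256 := by field_simp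
    have hle : ε ^ 2 / (256 * n) ≤ ε ^ 2 / 256 := by
      rw [← hne]
      exact le_mul_of_one_le_left he.le hn'
    have hε2 : ε ^ 2 ≤ ε := by nlinarith
    have he1 : ε ^ 2 / (256 * n) < 1 := by linarith
    refine ⟨fun i l => quantileVector_mem_Ioc hδ he he1 (Nat.lt_succ_iff.1 l.2),
      fun D hD h0 hreg => ?_⟩
    have : NeZero n := ⟨by omega⟩
    have hEMR : mechanismEMR n ε = quantileMyerson n (ε / 4) (ε ^ 2 / (256 * n)) := rfl
    rw [hEMR]
    refine ⟨myerson_isFeasible, quantileMyerson_isDSIC h0 hreg hδ he he1,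
      quantileMyerson_isExPostIR h0 hreg hδ he he1,
      quantileMyerson_integrable_pay h0 hreg hδ he he1, ?_⟩
    have hr := quantileMyerson_revenue_nonneg h0 hreg hδ he he1
    -- It suffices to bound each mechanism's revenue by the same real number, which also shows that
    -- the supremum is finite.
    rw [EReal.div_le_iff_le_mul (by exact_mod_cast (by linarith : (0 : ℝ) < 1 + ε))
      (EReal.coe_ne_top _), ← EReal.coe_mul]
    refine iSup₂_le fun M hM => EReal.coe_le_coe_iff.2 ?_
    have happ := quantileMyerson_approx h0 hreg hδ he he1 hM (by rw [hne]; linarith)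
    rw [hne] at happ
    set r := ((quantileMyerson n (ε / 4) (ε ^ 2 / (256 * n))).exec D).revenue D
    set x := (1 - ε ^ 2 / (256 * n)) * (1 - ε ^ 2 / 256) with hx
    have hx0 : 1 - ε / 128 ≤ x := by
      have : x = 1 - ε ^ 2 / (256 * n) - ε ^ 2 / 256 + ε ^ 2 / (256 * n) * (ε ^ 2 / 256) := by
        rw [hx]; ring
      have := mul_nonneg he.le (by positivity : 0 ≤ ε ^ 2 / 256)
      linarith
    -- The loss (1 + δ)² is about 1 + ε/2, so half of ε is left for the second-order term and the
    -- truncation factor x.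
    have hxε : (1 + ε / 4) ^ 2 ≤ (1 + ε) * x :=
      calc (1 + ε / 4) ^ 2 = 1 + ε / 2 + ε ^ 2 / 16 := by ring
        _ ≤ 1 + ε - ε / 128 - ε ^ 2 / 128 := by linarith
        _ = (1 + ε) * (1 - ε / 128) := by ring
        _ ≤ (1 + ε) * x := mul_le_mul_of_nonneg_left hx0 (by linarith)
    have hxpos : 0 < x := by linarith
    have : x * M.revenue D ≤ x * ((1 + ε) * r) :=
      calc x * M.revenue D ≤ (1 + ε / 4) ^ 2 * r := happ
        _ ≤ (1 + ε) * x * r := mul_le_mul_of_nonneg_right hxε hr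
        _ = x * ((1 + ε) * r) := by ring
    exact le_of_mul_le_mul_left this hxpos
  · refine ⟨(4 * Real.log 256 + 2 * Real.log 2) / Real.log c + 8, ?_,
      fun n hn ε hε hε1 hcn => queryComplexity_mechanismEMR_le hc hn hε hε1 hcn⟩
    have h1 := Real.log_pos hc
    have h2 : 0 < Real.log 256 := Real.log_pos (by norm_num)
    have h3 : 0 < Real.log 2 := Real.log_pos (by norm_num)
    positivity
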